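/- Let $d\ge 1$ be an integer and let $\mathbb{B}^d=\{z\in\mathbb{C}^d : |z|<1\}$ be the open unit ball. Write $d\tau(z)=(1-|z|^2)^{-(d+1)}\,dz$, where $dz$ is $2d$-dimensional Lebesgue measure. For real $\sigma>d$ let $\mu_\sigma$ be the measure on $\mathbb{B}^d$ given by $$d\mu_\sigma(z)=c_\sigma(1-|z|^2)^{\sigma}\,d\tau(z),\qquad c_\sigma=\frac{\Gamma(\sigma)}{\pi^d\,\Gamma(\sigma-d)},$$ and let $\mathcal{H}L^2(\mathbb{B}^d,\mu_\sigma)$ be the set of holomorphic functions on $\mathbb{B}^d$ that are square-integrable with respect to $\mu_\sigma$. Let $N=\sum_{j=1}^d z_j\,\partial/\partial z_j$. For real $\lambda>0$ choose an integer $n\ge 0$ with $\lambda+2n>d$ and set $$H(\mathbb{B}^d,\lambda)=\{f \text{ holomorphic on } \mathbb{B}^d : N^k f\in \mathcal{H}L^2(\mathbb{B}^d,\mu_{\lambda+2n}) \text{ for all } 0\le k\le n\}.$$ Then for all real $\lambda_1,\lambda_2>0$: if $f\in H(\mathbb{B}^d,\lambda_1)$ and $g\in H(\mathbb{B}^d,\lambda_2)$,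 then $fg\in H(\mathbb{B}^d,\lambda_1+\lambda_2)$. This holds for every choice of the admissible integers $n_1$, $n_2$, $n_3$ (with $\lambda_1+2n_1>d$, $\lambda_2+2n_2>d$, $\lambda_1+\lambda_2+2n_3>d$) used to define the three spaces $H(\mathbb{B}^d,\lambda_1)$, $H(\mathbb{B}^d,\lambda_2)$, $H(\mathbb{B}^d,\lambda_1+\lambda_2)$ respectively. -/

import Mathlib

noncomputable section

open MeasureTheory

/-- The open unit ball of `ℂ^d`, for the Hermitian (Euclidean) norm. -/
def unitBall (d : ℕ) : Set (EuclideanSpace ℂ (Fin d)) :=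
  Metric.ball 0 1

/-- Holomorphic functions on the ball. As usual, a function on the ball is given by a function on
the whole space, of which only the values on the ball matter. -/
def IsHolo (d : ℕ) (f : EuclideanSpace ℂ (Fin d) → ℂ) : Prop :=
  DifferentiableOn ℂ f (unitBall d)

/-- The hyperbolic volume `dτ(z) = (1 - |z|²)^{-(d+1)} dz` on the ball, where `dz` is the
unnormalized `2d`-dimensional Lebesgue measure. -/
def hypVolume (d : ℕ) : Measure (EuclideanSpace ℂ (Fin d)) :=
  (volume.restrict (unitBall d)).withDensity
    fun z => ENNReal.ofReal ((1 - ‖z‖ ^ 2) ^ (-((d : ℝ) + 1)))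

/-- The constant `c_s = Γ(s) / (π^d Γ(s - d))` for `s > d`. For `s ≤ d` the constant is an
arbitrary positive number (here `1`); that case is never used below. -/
def bergmanConst (d : ℕ) (s : ℝ) : ℝ :=
  if (d : ℝ) < s then Real.Gamma s / (Real.pi ^ d * Real.Gamma (s - d)) else 1

/-- The measure `dμ_s(z) = c_s (1 - |z|²)^s dτ(z)` on the ball. -/
def bergmanMeasure (d : ℕ) (s : ℝ) : Measure (EuclideanSpace ℂ (Fin d)) :=
  (hypVolume d).withDensity
    fun z => ENNReal.ofReal (bergmanConst d s * (1 - ‖z‖ ^ 2) ^ s)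

/-- The weighted Bergman space `𝓗L²(𝔹^d, μ_s)`: the holomorphic functions on the ball that are
square-integrable with respect to `μ_s`. -/
def bergmanSpace (d : ℕ) (s : ℝ) : Set (EuclideanSpace ℂ (Fin d) → ℂ) :=
  {f | IsHolo d f ∧ MemLp f 2 (bergmanMeasure d s)}

/-- The number operator `N = ∑ j, z_j ∂/∂z_j`, acting on holomorphic functions on the ball. -/
def numberOp (d : ℕ) (f : EuclideanSpace ℂ (Fin d) → ℂ) : EuclideanSpace ℂ (Fin d) → ℂ :=
  fun z => ∑ j : Fin d, z j * fderiv ℂ f z (EuclideanSpace.single j 1)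

/-- The space `H(𝔹^d, l)`, built with the auxiliary non-negative integer `n`, which is meant to
satisfy `l + 2n > d`: the holomorphic `f` on the ball with `N^k f ∈ 𝓗L²(𝔹^d, μ_{l+2n})` for
`0 ≤ k ≤ n`. -/
def genBergmanSpace (d n : ℕ) (l : ℝ) : Set (EuclideanSpace ℂ (Fin d) → ℂ) :=
  {f | IsHolo d f ∧ ∀ k ≤ n, (numberOp d)^[k] f ∈ bergmanSpace d (l + 2 * n)}

end

open MeasureTheory

/-! Write E_a(f) for the integral of |f|² (1 - |z|²)^a over the ball (`weightedEnergy`). Membership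
in the space of parameter l built with n means that E_{l+2n-d-1}(N^k f) is finite for all k ≤ n.
Four facts about a holomorphic f carry the proof. (1) If E_a(f) is finite, then |f| = O((1 -
|z|²)^{-(a+d+1)/2}) (`IsHolo.exists_growth_bound`): a sub-mean value inequality over a region of
volume comparable to (1 - |z|²)^{d+1}. (2) If E_a(f) is finite, so is E_{a+2}(Nf)
(`IsHolo.weightedEnergy_numberOp_lt_top`): Cauchy estimates and Tonelli. (3) Conversely, for a > -1,
finiteness of E_{a+2}(Nf) gives that of E_a(f) (`IsHolo.weightedEnergy_lt_top_of_numberOp`): a Hardy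
inequality along rays. (4) If Nf grows with order b + 1 and b > 0, then f grows with order b
(`IsHolo.hasBoundaryGrowth_of_numberOp`): integration along rays. By (2) and (3) the energy
conditions pass from one n to another. By (1), (2) and (4), N^i f grows with order l/2 + i for every
i; the descent by (4) needs only l > 0, whereas the descent of energies by (3) stops at exponent -1.
By the Leibniz rule, N^k(fg) with k ≤ n₁ + n₂ is a sum of products N^i f · N^j g with i + j = k. In
each product one factor is put in a weighted L² space and the other is bounded by its growth, and
the exponents add up to that of parameter l₁ + l₂ and integer n₁ + n₂. It remains to pass from n₁ +
n₂ to n₃. -/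

/-! ### The number operator on holomorphic functions. -/

theorem isOpen_unitBall (d : ℕ) : IsOpen (unitBall d) := Metric.isOpen_ball

theorem mem_unitBall {d : ℕ} {z : EuclideanSpace ℂ (Fin d)} : z ∈ unitBall d ↔ ‖z‖ < 1 :=
  mem_ball_zero_iff

theorem one_sub_norm_sq_pos {d : ℕ} {z : EuclideanSpace ℂ (Fin d)} (hz : z ∈ unitBall d) :
    0 < 1 - ‖z‖ ^ 2 := by
  have := mem_unitBall.1 hz
  nlinarith [norm_nonneg z]

theorem IsHolo.differentiableAt {d : ℕ} {f : EuclideanSpace ℂ (Fin d) → ℂ} (hf : IsHolo d f)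
    {z : EuclideanSpace ℂ (Fin d)} (hz : z ∈ unitBall d) : DifferentiableAt ℂ f z :=
  DifferentiableOn.differentiableAt hf ((isOpen_unitBall d).mem_nhds hz)

/-- N is the radial derivative, so every later argument can be made in one variable along the
complex line through z. -/
theorem numberOp_eq_fderiv {d : ℕ} (f : EuclideanSpace ℂ (Fin d) → ℂ)
    (z : EuclideanSpace ℂ (Fin d)) : numberOp d f z = fderiv ℂ f z z := by
  have hz : z = ∑ j : Fin d, z j • EuclideanSpace.single j (1 : ℂ) := by
    ext i
    simp [Finset.sum_apply, Pi.single_apply]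
  conv_rhs => rw [hz, map_sum]
  simp only [numberOp, map_smul, smul_eq_mul]
  rw [← hz]

theorem numberOp_congr {d : ℕ} {f g : EuclideanSpace ℂ (Fin d) → ℂ}
    (h : Set.EqOn f g (unitBall d)) : Set.EqOn (numberOp d f) (numberOp d g) (unitBall d) := by
  intro z hz
  rw [numberOp_eq_fderiv, numberOp_eq_fderiv,
    (h.eventuallyEq_of_mem ((isOpen_unitBall d).mem_nhds hz)).fderiv_eq]

theorem numberOp_iterate_congr {d : ℕ} {f g : EuclideanSpace ℂ (Fin d) → ℂ}
    (h : Set.EqOn f g (unitBall d)) (k : ℕ) :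
    Set.EqOn ((numberOp d)^[k] f) ((numberOp d)^[k] g) (unitBall d) := by
  induction k with
  | zero => exact h
  | succ k ih =>
    simp only [Function.iterate_succ_apply']
    exact numberOp_congr ih

theorem numberOp_add {d : ℕ} {f g : EuclideanSpace ℂ (Fin d) → ℂ} (hf : IsHolo d f)
    (hg : IsHolo d g) :
    Set.EqOn (numberOp d (fun z => f z + g z)) (fun z => numberOp d f z + numberOp d g z)
      (unitBall d) := by
  intro z hz
  simp only [numberOp_eq_fderiv]
  rw [fderiv_fun_add (hf.differentiableAt hz) (hg.differentiableAt hz)]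
  rfl

theorem numberOp_mul {d : ℕ} {f g : EuclideanSpace ℂ (Fin d) → ℂ} (hf : IsHolo d f)
    (hg : IsHolo d g) :
    Set.EqOn (numberOp d (fun z => f z * g z))
      (fun z => numberOp d f z * g z + f z * numberOp d g z) (unitBall d) := by
  intro z hz
  simp only [numberOp_eq_fderiv]
  rw [fderiv_fun_mul (hf.differentiableAt hz) (hg.differentiableAt hz)]
  simp [mul_comm, add_comm]

theorem smul_mem_unitBall {d : ℕ} {z : EuclideanSpace ℂ (Fin d)} (hz : z ∈ unitBall d) {t : ℂ}
    (ht : ‖t‖ ≤ 1) : t • z ∈ unitBall d := by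
  rw [mem_unitBall] at *
  rw [norm_smul]
  nlinarith [norm_nonneg z]

theorem IsHolo.hasDerivAt_add_smul {d : ℕ} {f : EuclideanSpace ℂ (Fin d) → ℂ} (hf : IsHolo d f)
    {z v : EuclideanSpace ℂ (Fin d)} {t : ℂ} (h : z + t • v ∈ unitBall d) :
    HasDerivAt (fun s : ℂ => f (z + s • v)) (fderiv ℂ f (z + t • v) v) t := by
  have h1 : HasDerivAt (fun s : ℂ => z + s • v) v t := by
    simpa using ((hasDerivAt_id t).smul_const v).const_add z
  exact (hf.differentiableAt h).hasFDerivAt.comp_hasDerivAt t h1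

theorem IsHolo.exists_bound_closedBall {d : ℕ} {f : EuclideanSpace ℂ (Fin d) → ℂ}
    (hf : IsHolo d f) {R : ℝ} (hR : R < 1) :
    ∃ M, 0 ≤ M ∧ ∀ z, ‖z‖ ≤ R → ‖f z‖ ≤ M := by
  have hsub : Metric.closedBall (0 : EuclideanSpace ℂ (Fin d)) R ⊆ unitBall d :=
    Metric.closedBall_subset_ball hR
  obtain ⟨M, hM⟩ := (isCompact_closedBall (0 : EuclideanSpace ℂ (Fin d)) R).exists_bound_of_continuousOn
    (DifferentiableOn.continuousOn hf |>.mono hsub)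
  exact ⟨max M 0, le_max_right _ _, fun z hz => (hM z (by simpa using hz)).trans (le_max_left _ _)⟩

theorem IsHolo.exists_fderiv_bound_closedBall {d : ℕ} {f : EuclideanSpace ℂ (Fin d) → ℂ}
    (hf : IsHolo d f) {R : ℝ} (hR : R < 1) :
    ∃ M, 0 ≤ M ∧ ∀ z, ‖z‖ ≤ R → ‖fderiv ℂ f z‖ ≤ M := by
  obtain ⟨M, hM0, hM⟩ := hf.exists_bound_closedBall (R := (1 + R) / 2) (by linarith)
  refine ⟨(2 * M + 1) / ((1 - R) / 2), div_nonneg (by linarith) (by linarith), fun z hz => ?_⟩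
  have hin : ∀ w ∈ Metric.ball z ((1 - R) / 2), ‖w‖ ≤ (1 + R) / 2 := by
    intro w hw
    have h1 := norm_le_norm_add_norm_sub' w z
    rw [mem_ball_iff_norm] at hw
    linarith
  refine Complex.norm_fderiv_le_div_of_mapsTo_ball (hf.mono fun w hw => ?_) (fun w hw => ?_)
    (by linarith)
  · exact mem_unitBall.2 (by linarith [hin w hw])
  · rw [mem_closedBall_iff_norm]
    have := norm_sub_le (f w) (f z)
    linarith [hM w (hin w hw), hM z (by linarith)]

/-- Nf(z) is the derivative at t = 0 of f(z + tz), hence a Cauchy integral over a small circle in t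
whose radius can be kept fixed for z near z₀; differentiating under the integral needs only a local
bound on the derivative of f. -/
theorem IsHolo.holo_numberOp {d : ℕ} {f : EuclideanSpace ℂ (Fin d) → ℂ} (hf : IsHolo d f) :
    IsHolo d (numberOp d f) := by
  intro z₀ hz₀
  have hz₀' := mem_unitBall.1 hz₀
  set R : ℝ := (1 + ‖z₀‖) / 2 with hR
  have hR0 : 0 < R := by positivity
  have hR1 : R < 1 := by rw [hR]; linarith
  -- With |z| < R and |t| ≤ ρ, the point z + tz stays within R + ρ = (1 + R)/2 < 1.
  set ρ : ℝ := (1 - R) / 2 with hρ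
  have hρ0 : 0 < ρ := by rw [hρ]; linarith
  have hdil : ∀ z : EuclideanSpace ℂ (Fin d), ‖z‖ < R → ∀ t : ℂ, ‖t‖ ≤ ρ →
      ‖z + t • z‖ ≤ (1 + R) / 2 := by
    intro z hz t ht
    have h1 := norm_add_le z (t • z)
    rw [norm_smul] at h1
    nlinarith [norm_nonneg z, norm_nonneg t]
  have hcirc : ∀ θ, ‖circleMap 0 ρ θ‖ ≤ ρ := fun θ => by simp [abs_of_pos hρ0]
  have hmem : ∀ z : EuclideanSpace ℂ (Fin d), ‖z‖ < R → ∀ t : ℂ, ‖t‖ ≤ ρ →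
      z + t • z ∈ unitBall d := fun z hz t ht =>
    mem_unitBall.2 (by linarith [hdil z hz t ht])
  obtain ⟨M, hM0, hM⟩ := hf.exists_fderiv_bound_closedBall (R := (1 + R) / 2) (by linarith)
  -- The Cauchy kernel dt / t² for a first derivative, on the circle parametrized by θ.
  set c : ℝ → ℂ := fun θ => circleMap 0 ρ θ * Complex.I * ((circleMap 0 ρ θ) ^ 2)⁻¹ with hc
  have hcc : Continuous c := by
    refine ((continuous_circleMap 0 ρ).mul continuous_const).mul
      (((continuous_circleMap 0 ρ).pow 2).inv₀ fun θ => ?_)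
    exact pow_ne_zero _ (circleMap_ne_center hρ0.ne')
  have hcn : ∀ θ, ‖c θ‖ ≤ ρ⁻¹ := by
    intro θ
    simp only [hc, norm_mul, norm_inv, norm_pow, Complex.norm_I, norm_circleMap_zero,
      abs_of_pos hρ0]
    refine le_of_eq ?_
    field_simp
  set F : EuclideanSpace ℂ (Fin d) → ℝ → ℂ :=
    fun z θ => c θ * f (z + circleMap 0 ρ θ • z) with hF
  set F' : EuclideanSpace ℂ (Fin d) → ℝ → EuclideanSpace ℂ (Fin d) →L[ℂ] ℂ :=
    fun z θ => (c θ * (1 + circleMap 0 ρ θ)) • fderiv ℂ f (z + circleMap 0 ρ θ • z) with hF'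
  have hrep : ∀ z : EuclideanSpace ℂ (Fin d), ‖z‖ < R →
      numberOp d f z = (2 * Real.pi * Complex.I)⁻¹ * ∫ θ in 0..2 * Real.pi, F z θ := by
    intro z hz
    have h0 : HasDerivAt (fun s : ℂ => f (z + s • z)) (fderiv ℂ f z z) 0 := by
      simpa using hf.hasDerivAt_add_smul (z := z) (v := z) (t := 0)
        (hmem z hz 0 (by simpa using hρ0.le))
    have hU : IsOpen {t : ℂ | z + t • z ∈ unitBall d} :=
      (isOpen_unitBall d).preimage (by fun_prop)
    have h1 := Complex.cderiv_eq_deriv (f := fun s : ℂ => f (z + s • z)) (z := 0) hU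
      (fun t ht => (hf.hasDerivAt_add_smul ht).differentiableAt.differentiableWithinAt) hρ0
      (fun t ht => hmem z hz t (by simpa using ht))
    rw [numberOp_eq_fderiv, ← h0.deriv, ← h1, Complex.cderiv, circleIntegral]
    simp only [smul_eq_mul, deriv_circleMap, sub_zero, hF, hc, mul_assoc]
  have hball : Metric.ball (0 : EuclideanSpace ℂ (Fin d)) R ∈ nhds z₀ :=
    Metric.isOpen_ball.mem_nhds (by rw [mem_ball_zero_iff, hR]; linarith)
  have hFc : ∀ z : EuclideanSpace ℂ (Fin d), ‖z‖ < R → Continuous (F z) := by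
    intro z hz
    refine hcc.mul ?_
    refine (DifferentiableOn.continuousOn hf).comp_continuous
      (continuous_const.add ((continuous_circleMap 0 ρ).smul continuous_const)) fun θ =>
        hmem z hz _ (hcirc θ)
  have hz₀R : ‖z₀‖ < R := by rw [hR]; linarith
  have key := intervalIntegral.hasFDerivAt_integral_of_dominated_of_fderiv_le (𝕜 := ℂ)
    (μ := volume) (a := 0) (b := 2 * Real.pi) (F := F) (F' := F') (x₀ := z₀)
    (bound := fun _ => ρ⁻¹ * (1 + ρ) * M) hball
    (Filter.eventually_of_mem hball fun z hz =>
      (hFc z (by simpa using hz)).aestronglyMeasurable)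
    ((hFc z₀ hz₀R).intervalIntegrable _ _)
    (by
      have hsm : StronglyMeasurable fun θ : ℝ => fderiv ℂ f (z₀ + circleMap 0 ρ θ • z₀) :=
        ((measurable_fderiv ℂ f).comp (continuous_const.add
          ((continuous_circleMap 0 ρ).smul continuous_const)).measurable).stronglyMeasurable
      refine AEStronglyMeasurable.smul (Continuous.aestronglyMeasurable (?_ : Continuous
        fun θ => c θ * (1 + circleMap 0 ρ θ))) hsm.aestronglyMeasurable
      exact hcc.mul (continuous_const.add (continuous_circleMap 0 ρ)))
    (by
      refine Filter.Eventually.of_forall fun θ _ z hz => ?_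
      have hz' : ‖z‖ < R := by simpa using hz
      simp only [hF', norm_smul, norm_mul]
      have h2 : ‖1 + circleMap 0 ρ θ‖ ≤ 1 + ρ :=
        (norm_add_le _ _).trans (by simpa using hcirc θ)
      gcongr
      · exact hcn θ
      · exact hM _ (hdil z hz' _ (hcirc θ)))
    (by simp)
    (by
      refine Filter.Eventually.of_forall fun θ _ z hz => ?_
      have hz' : ‖z‖ < R := by simpa using hz
      have h3 : HasFDerivAt (fun w : EuclideanSpace ℂ (Fin d) => w + circleMap 0 ρ θ • w)
          ((1 + circleMap 0 ρ θ) • ContinuousLinearMap.id ℂ _) z := by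
        refine ((hasFDerivAt_id (𝕜 := ℂ) z).add ((hasFDerivAt_id (𝕜 := ℂ) z).const_smul
          (circleMap 0 ρ θ))).congr_fderiv ?_
        ext v
        simp [add_mul]
      have h4 := ((hf.differentiableAt (hmem z hz' _ (hcirc θ))).hasFDerivAt.comp z h3).const_mul
        (c θ)
      refine h4.congr_fderiv ?_
      ext v
      simp [hF', mul_assoc])
  refine ((key.const_mul ((2 * Real.pi * Complex.I)⁻¹)).differentiableAt.congr_of_eventuallyEq
    ?_).differentiableWithinAt
  exact Filter.eventually_of_mem hball fun z hz => hrep z (by simpa using hz)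

theorem IsHolo.holo_numberOp_iterate {d : ℕ} {f : EuclideanSpace ℂ (Fin d) → ℂ} (hf : IsHolo d f)
    (k : ℕ) : IsHolo d ((numberOp d)^[k] f) := by
  induction k with
  | zero => exact hf
  | succ k ih =>
    rw [Function.iterate_succ_apply']
    exact ih.holo_numberOp

theorem IsHolo.add {d : ℕ} {f g : EuclideanSpace ℂ (Fin d) → ℂ} (hf : IsHolo d f)
    (hg : IsHolo d g) : IsHolo d (fun z => f z + g z) :=
  DifferentiableOn.fun_add hf hg

theorem IsHolo.mul {d : ℕ} {f g : EuclideanSpace ℂ (Fin d) → ℂ} (hf : IsHolo d f)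
    (hg : IsHolo d g) : IsHolo d (fun z => f z * g z) :=
  DifferentiableOn.fun_mul hf hg

/-! ### Weighted energies and Bergman spaces. -/

/-- The weight `(1 - |z|²)^a`, as an extended non-negative real. -/
noncomputable def ballWeight {d : ℕ} (a : ℝ) (z : EuclideanSpace ℂ (Fin d)) : ENNReal :=
  ENNReal.ofReal ((1 - ‖z‖ ^ 2) ^ a)

/-- The weighted energy `∫ |f|² (1 - |z|²)^a dz` over the ball. -/
noncomputable def weightedEnergy (d : ℕ) (a : ℝ) (f : EuclideanSpace ℂ (Fin d) → ℂ) : ENNReal :=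
  ∫⁻ z in unitBall d, ‖f z‖ₑ ^ 2 * ballWeight a z

theorem measurable_ballWeight {d : ℕ} (a : ℝ) :
    Measurable (ballWeight a : EuclideanSpace ℂ (Fin d) → ENNReal) := by
  unfold ballWeight
  fun_prop

theorem ballWeight_mul {d : ℕ} (a b : ℝ) {z : EuclideanSpace ℂ (Fin d)} (hz : z ∈ unitBall d) :
    ballWeight a z * ballWeight b z = ballWeight (a + b) z := by
  have h := one_sub_norm_sq_pos hz
  rw [ballWeight, ballWeight, ballWeight, ← ENNReal.ofReal_mul (by positivity), Real.rpow_add h]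

theorem ballWeight_zero {d : ℕ} (z : EuclideanSpace ℂ (Fin d)) : ballWeight 0 z = 1 := by
  simp [ballWeight]

theorem ballWeight_ne_top {d : ℕ} (a : ℝ) (z : EuclideanSpace ℂ (Fin d)) :
    ballWeight a z ≠ ⊤ := ENNReal.ofReal_ne_top

theorem ballWeight_anti {d : ℕ} {a b : ℝ} (hab : a ≤ b) {z : EuclideanSpace ℂ (Fin d)}
    (hz : z ∈ unitBall d) : ballWeight b z ≤ ballWeight a z :=
  ENNReal.ofReal_le_ofReal
    (Real.rpow_le_rpow_of_exponent_ge (one_sub_norm_sq_pos hz) (by nlinarith [norm_nonneg z]) hab)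

theorem measurableSet_unitBall (d : ℕ) : MeasurableSet (unitBall d) :=
  (isOpen_unitBall d).measurableSet

theorem weightedEnergy_mono_exponent {d : ℕ} {a b : ℝ} (hab : a ≤ b)
    (f : EuclideanSpace ℂ (Fin d) → ℂ) : weightedEnergy d b f ≤ weightedEnergy d a f :=
  setLIntegral_mono' (measurableSet_unitBall d) fun z hz => by
    gcongr; exact ballWeight_anti hab hz

theorem weightedEnergy_congr {d : ℕ} (a : ℝ) {f g : EuclideanSpace ℂ (Fin d) → ℂ}
    (h : Set.EqOn f g (unitBall d)) : weightedEnergy d a f = weightedEnergy d a g :=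
  setLIntegral_congr_fun (measurableSet_unitBall d) fun z hz => by simp only [h hz]

theorem IsHolo.aemeasurable_enorm {d : ℕ} {f : EuclideanSpace ℂ (Fin d) → ℂ} (hf : IsHolo d f) :
    AEMeasurable (fun z => ‖f z‖ₑ) (volume.restrict (unitBall d)) :=
  ((DifferentiableOn.continuousOn hf).aestronglyMeasurable (measurableSet_unitBall d)).enorm

theorem weightedEnergy_add_lt_top {d : ℕ} {a : ℝ} {f g : EuclideanSpace ℂ (Fin d) → ℂ}
    (hf : IsHolo d f) (hfa : weightedEnergy d a f < ⊤) (hga : weightedEnergy d a g < ⊤) :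
    weightedEnergy d a (fun z => f z + g z) < ⊤ := by
  have h : weightedEnergy d a (fun z => f z + g z)
      ≤ 2 * (weightedEnergy d a f + weightedEnergy d a g) := by
    have hm : AEMeasurable (fun z => ‖f z‖ₑ ^ 2 * ballWeight a z)
        (volume.restrict (unitBall d)) :=
      (hf.aemeasurable_enorm.pow_const 2).mul (measurable_ballWeight a).aemeasurable
    unfold weightedEnergy
    rw [← lintegral_add_left' hm, ← lintegral_const_mul' _ _ (by simp)]
    refine lintegral_mono fun z => ?_
    have h1 : ‖f z + g z‖ₑ ^ 2 ≤ 2 * (‖f z‖ₑ ^ 2 + ‖g z‖ₑ ^ 2) := by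
      have := add_sq_le (a := ‖f z‖₊) (b := ‖g z‖₊)
      calc ‖f z + g z‖ₑ ^ 2 ≤ (‖f z‖ₑ + ‖g z‖ₑ) ^ 2 := by gcongr; exact enorm_add_le _ _
        _ ≤ _ := by
          simp only [enorm_eq_nnnorm]
          exact_mod_cast this
    calc ‖f z + g z‖ₑ ^ 2 * ballWeight a z
        ≤ 2 * (‖f z‖ₑ ^ 2 + ‖g z‖ₑ ^ 2) * ballWeight a z := by gcongr
      _ = _ := by ring
  exact h.trans_lt (ENNReal.mul_lt_top (by simp) (ENNReal.add_lt_top.2 ⟨hfa, hga⟩))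

/-- The density of μ_s is a positive constant times (1 - |z|²)^{s-(d+1)}, and the constant does not
affect finiteness. -/
theorem mem_bergmanSpace_iff {d : ℕ} {s : ℝ} (hs : (d : ℝ) < s)
    {f : EuclideanSpace ℂ (Fin d) → ℂ} (hf : IsHolo d f) :
    f ∈ bergmanSpace d s ↔ weightedEnergy d (s - d - 1) f < ⊤ := by
  have hac : bergmanMeasure d s ≪ volume.restrict (unitBall d) :=
    (withDensity_absolutelyContinuous _ _).trans (withDensity_absolutelyContinuous _ _)
  have hsm : AEStronglyMeasurable f (bergmanMeasure d s) :=
    ((DifferentiableOn.continuousOn hf).aestronglyMeasurable (measurableSet_unitBall d)).mono_ac hac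
  have hd : (0 : ℝ) ≤ d := Nat.cast_nonneg d
  have hc : 0 < bergmanConst d s := by
    rw [bergmanConst, if_pos hs]
    have := Real.Gamma_pos_of_pos (show 0 < s by linarith)
    have := Real.Gamma_pos_of_pos (show 0 < s - d by linarith)
    positivity
  have hm1 : Measurable fun z : EuclideanSpace ℂ (Fin d) =>
      ENNReal.ofReal ((1 - ‖z‖ ^ 2) ^ (-((d : ℝ) + 1))) := by fun_prop
  have hm2 : Measurable fun z : EuclideanSpace ℂ (Fin d) =>
      ENNReal.ofReal (bergmanConst d s * (1 - ‖z‖ ^ 2) ^ s) := by fun_prop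
  have hint : ∫⁻ z, ‖f z‖ₑ ^ 2 ∂(bergmanMeasure d s)
      = ENNReal.ofReal (bergmanConst d s) * weightedEnergy d (s - d - 1) f := by
    rw [bergmanMeasure, lintegral_withDensity_eq_lintegral_mul_non_measurable _ hm2
      (by simp), hypVolume, lintegral_withDensity_eq_lintegral_mul_non_measurable _ hm1 (by simp),
      weightedEnergy, ← lintegral_const_mul' _ _ ENNReal.ofReal_ne_top]
    refine setLIntegral_congr_fun (measurableSet_unitBall d) fun z hz => ?_
    have hz' := one_sub_norm_sq_pos hz
    simp only [Pi.mul_apply]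
    rw [ENNReal.ofReal_mul hc.le, show s - d - 1 = -((d : ℝ) + 1) + s by ring,
      ← ballWeight_mul _ _ hz]
    simp only [ballWeight]
    ring
  have hmem : MemLp f 2 (bergmanMeasure d s) ↔ weightedEnergy d (s - d - 1) f < ⊤ := by
    rw [MemLp, and_iff_right hsm, eLpNorm_lt_top_iff_lintegral_rpow_enorm_lt_top (by simp) (by simp)]
    simp only [ENNReal.toReal_ofNat, ENNReal.rpow_ofNat]
    rw [hint]
    constructor
    · intro h
      by_contra h'
      rw [not_lt_top_iff] at h'
      rw [h', ENNReal.mul_top (by simpa using hc)] at h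
      exact lt_irrefl _ h
    · exact fun h => ENNReal.mul_lt_top ENNReal.ofReal_lt_top h
  simp only [bergmanSpace, Set.mem_ofPred_eq, hf, true_and, hmem]

/-! ### Sub-mean value inequalities over balanced sets. -/

/-- Outside the ball f is arbitrary; the cut-off is measurable on the whole space, as Tonelli and
translations require. -/
theorem IsHolo.measurable_indicator {d : ℕ} {f : EuclideanSpace ℂ (Fin d) → ℂ} (hf : IsHolo d f) :
    Measurable ((unitBall d).indicator fun z => ‖f z‖ₑ ^ 2) := by
  classical
  rw [← Set.piecewise_eq_indicator]
  refine ContinuousOn.measurable_piecewise ?_ continuousOn_const (measurableSet_unitBall d)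
  exact (ENNReal.continuous_pow 2).comp_continuousOn
    (continuous_enorm.comp_continuousOn (DifferentiableOn.continuousOn hf))

/-- Multiplication by a unit complex number as a real linear isometry. -/
noncomputable def unitSMulIsometry (d : ℕ) (c : ℂ) (hc : ‖c‖ = 1) :
    EuclideanSpace ℂ (Fin d) ≃ₗᵢ[ℝ] EuclideanSpace ℂ (Fin d) where
  toLinearEquiv := (LinearEquiv.smulOfNeZero ℂ (EuclideanSpace ℂ (Fin d)) c
    (norm_ne_zero_iff.1 (by simp [hc]))).restrictScalars ℝ
  norm_map' z := by
    change ‖c • z‖ = ‖z‖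
    rw [norm_smul, hc, one_mul]

theorem measurePreserving_unit_smul {d : ℕ} {c : ℂ} (hc : ‖c‖ = 1) :
    MeasurePreserving (fun z : EuclideanSpace ℂ (Fin d) => c • z) volume volume :=
  (unitSMulIsometry d c hc).measurePreserving

theorem Balanced.preimage_unit_smul {E : Type*} [AddCommGroup E] [Module ℂ E] {S : Set E}
    (hS : Balanced ℂ S) {c : ℂ} (hc : ‖c‖ = 1) : (fun z => c • z) ⁻¹' S = S := by
  have hc0 : c ≠ 0 := norm_ne_zero_iff.1 (by simp [hc])
  ext v
  constructor
  · intro h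
    have := hS.smul_mem (a := c⁻¹) (by simp [hc]) h
    simpa [smul_smul, inv_mul_cancel₀ hc0] using this
  · exact fun h => hS.smul_mem hc.le h

/-- The mean value property of the holomorphic function f² on a disc in the direction v, followed by
the triangle inequality. -/
theorem IsHolo.enorm_sq_le_circle {d : ℕ} {f : EuclideanSpace ℂ (Fin d) → ℂ} (hf : IsHolo d f)
    {z v : EuclideanSpace ℂ (Fin d)} (h : ∀ t : ℂ, ‖t‖ ≤ 1 → z + t • v ∈ unitBall d) :
    ‖f z‖ₑ ^ 2 ≤ ENNReal.ofReal (2 * Real.pi)⁻¹ *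
      ∫⁻ θ in Set.Ioc 0 (2 * Real.pi), ‖f (z + circleMap 0 1 θ • v)‖ₑ ^ 2 := by
  have hd : DifferentiableOn ℂ (fun t : ℂ => f (z + t • v) ^ 2) (Metric.closedBall 0 1) := by
    intro t ht
    exact ((hf.hasDerivAt_add_smul (h t (by simpa using ht))).differentiableAt.pow
      2).differentiableWithinAt
  have h1 := DiffContOnCl.circleAverage (f := fun t : ℂ => f (z + t • v) ^ 2) (c := 0) (R := 1)
    (by
      refine DifferentiableOn.diffContOnCl ?_
      rw [abs_one]
      exact hd.mono Metric.closure_ball_subset_closedBall)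
  simp only [Real.circleAverage, zero_smul, add_zero] at h1
  rw [intervalIntegral.integral_of_le (by positivity)] at h1
  rw [← enorm_pow, ← h1, enorm_smul, Real.enorm_eq_ofReal (by positivity)]
  gcongr
  refine (enorm_integral_le_lintegral_enorm _).trans_eq ?_
  simp only [enorm_pow]

/-- Integrate the circle inequality over v in S. After swapping the integrals, each rotation
preserves both S and Lebesgue measure, so the average over θ disappears. Any balanced shape is
allowed, in particular a nonisotropic one. -/
theorem IsHolo.enorm_sq_mul_volume_le {d : ℕ} {f : EuclideanSpace ℂ (Fin d) → ℂ}
    (hf : IsHolo d f) {z : EuclideanSpace ℂ (Fin d)} {S : Set (EuclideanSpace ℂ (Fin d))}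
    (hSm : MeasurableSet S) (hS : Balanced ℂ S) (hzS : ∀ v ∈ S, z + v ∈ unitBall d) :
    ‖f z‖ₑ ^ 2 * volume S ≤ ∫⁻ v in S, (unitBall d).indicator (fun z => ‖f z‖ₑ ^ 2) (z + v) := by
  set G := (unitBall d).indicator fun z => ‖f z‖ₑ ^ 2 with hG
  have hGm : Measurable G := hf.measurable_indicator
  have hc : ∀ θ : ℝ, ‖circleMap 0 1 θ‖ = 1 := fun θ => by simp
  calc ‖f z‖ₑ ^ 2 * volume S = ∫⁻ _ in S, ‖f z‖ₑ ^ 2 := by simp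
    _ ≤ ∫⁻ v in S, ENNReal.ofReal (2 * Real.pi)⁻¹ *
        ∫⁻ θ in Set.Ioc 0 (2 * Real.pi), G (z + circleMap 0 1 θ • v) := by
      refine setLIntegral_mono' hSm fun v hv => ?_
      refine (hf.enorm_sq_le_circle (z := z) (v := v) fun t ht =>
        hzS _ (hS.smul_mem ht hv)).trans_eq ?_
      congr 1
      refine lintegral_congr fun θ => ?_
      rw [hG, Set.indicator_of_mem (hzS _ (hS.smul_mem (hc θ).le hv))]
    _ = ENNReal.ofReal (2 * Real.pi)⁻¹ *
        ∫⁻ θ in Set.Ioc 0 (2 * Real.pi), ∫⁻ v in S, G (z + circleMap 0 1 θ • v) := by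
      rw [lintegral_const_mul' _ _ ENNReal.ofReal_ne_top, lintegral_lintegral_swap]
      refine (hGm.comp ?_).aemeasurable
      exact (continuous_const.add (((continuous_circleMap 0 1).comp continuous_snd).smul
        continuous_fst)).measurable
    _ = ENNReal.ofReal (2 * Real.pi)⁻¹ *
        ∫⁻ θ in Set.Ioc 0 (2 * Real.pi), ∫⁻ v in S, G (z + v) := by
      congr 1
      refine lintegral_congr fun θ => ?_
      have h2 := (measurePreserving_unit_smul (d := d) (hc θ)).setLIntegral_comp_preimage hSm
        (hGm.comp (measurable_const_add z))
      rw [hS.preimage_unit_smul (hc θ)] at h2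
      exact h2
    _ = ∫⁻ v in S, G (z + v) := by
      rw [setLIntegral_const, Real.volume_Ioc, mul_comm (lintegral _ _), ← mul_assoc,
        ← ENNReal.ofReal_mul (by positivity), sub_zero, inv_mul_cancel₀ (by positivity)]
      simp

/-! ### Nonisotropic regions and pointwise growth. -/

/-- The nonisotropic region around `z`, seen from `z`: radius `ρ` in the complex tangential
directions and of size `ρ²` in the complex normal direction. -/
def nonisotropicRegion {d : ℕ} (z : EuclideanSpace ℂ (Fin d)) (ρ : ℝ) :
    Set (EuclideanSpace ℂ (Fin d)) :=
  {v | ‖v‖ < ρ ∧ ‖inner ℂ z v‖ < ρ ^ 2}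

theorem isOpen_nonisotropicRegion {d : ℕ} (z : EuclideanSpace ℂ (Fin d)) (ρ : ℝ) :
    IsOpen (nonisotropicRegion z ρ) :=
  (isOpen_lt continuous_norm continuous_const).inter
    (isOpen_lt (continuous_const.inner continuous_id).norm continuous_const)

theorem balanced_nonisotropicRegion {d : ℕ} (z : EuclideanSpace ℂ (Fin d)) (ρ : ℝ) :
    Balanced ℂ (nonisotropicRegion z ρ) := by
  rw [balanced_iff_smul_mem]
  rintro a ha v ⟨h1, h2⟩
  refine ⟨?_, ?_⟩
  · rw [norm_smul]
    nlinarith [norm_nonneg v]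
  · rw [inner_smul_right, norm_mul]
    nlinarith [norm_nonneg (inner ℂ z v)]

theorem finrank_real_euclideanSpace (d : ℕ) :
    Module.finrank ℝ (EuclideanSpace ℂ (Fin d)) = 2 * d := by
  rw [finrank_real_of_complex]
  simp

theorem volume_ball_eq {d : ℕ} (z : EuclideanSpace ℂ (Fin d)) {r : ℝ} (hr : 0 < r) :
    volume (Metric.ball z r) = ENNReal.ofReal (r ^ (2 * d)) * volume (unitBall d) := by
  rw [Measure.addHaar_ball_of_pos _ _ hr, finrank_real_euclideanSpace, unitBall]

theorem volume_unitBall_ne_zero (d : ℕ) : volume (unitBall d) ≠ 0 :=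
  (Metric.measure_ball_pos _ _ one_pos).ne'

theorem volume_unitBall_ne_top (d : ℕ) : volume (unitBall d) ≠ ⊤ :=
  measure_ball_lt_top.ne

theorem norm_sub_inner_smul_le {E : Type*} [NormedAddCommGroup E] [InnerProductSpace ℂ E]
    {e : E} (he : ‖e‖ = 1) (v : E) : ‖v - inner ℂ e v • e‖ ≤ ‖v‖ := by
  have hee : inner ℂ e e = 1 := by simp [inner_self_eq_norm_sq_to_K, he]
  have horth : inner ℂ (v - inner ℂ e v • e) (inner ℂ e v • e) = 0 := by
    rw [inner_smul_right, inner_sub_left, inner_smul_left, hee, inner_conj_symm]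
    simp
  have := norm_add_sq_eq_norm_sq_add_norm_sq_of_inner_eq_zero _ _ horth
  rw [sub_add_cancel] at this
  nlinarith [norm_nonneg v, norm_nonneg (v - inner ℂ e v • e), norm_nonneg (inner ℂ e v • e)]

/-- The order ρ^{2d+2}, rather than the ρ^{4d} of a ball of radius ρ², makes the growth bound sharp.
Instead of coordinates adapted to z, the proof computes the measure of an auxiliary set in ℂ × ℂ^d
by slicing it in two ways. -/
theorem volume_nonisotropicRegion_ge {d : ℕ} {z : EuclideanSpace ℂ (Fin d)} (hz : z ∈ unitBall d)
    {ρ : ℝ} (hρ : 0 < ρ) (hρ' : ρ ≤ 1 / 2) :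
    ENNReal.ofReal (ρ ^ 2 * (ρ / 2) ^ (2 * d)) * volume (unitBall d) ≤
      volume (nonisotropicRegion z ρ) := by
  have hρ2 : ρ ^ 2 ≤ ρ / 2 := by nlinarith
  rcases eq_or_ne z 0 with rfl | hz0
  · have : nonisotropicRegion (0 : EuclideanSpace ℂ (Fin d)) ρ = Metric.ball 0 ρ := by
      ext v
      simp [nonisotropicRegion, hρ]
    rw [this, volume_ball_eq _ hρ]
    gcongr
    have h1 : (ρ / 2) ^ (2 * d) ≤ ρ ^ (2 * d) := by gcongr; linarith
    have h2 : 0 ≤ (ρ / 2) ^ (2 * d) := by positivity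
    nlinarith
  set e : EuclideanSpace ℂ (Fin d) := ((‖z‖⁻¹ : ℝ) : ℂ) • z with he
  have hzn : ‖z‖ ≠ 0 := norm_ne_zero_iff.2 hz0
  have hen : ‖e‖ = 1 := by
    rw [he, norm_smul]; simp [hzn]
  have hze : z = (‖z‖ : ℂ) • e := by
    rw [he, smul_smul]; simp [hzn]
  set S := nonisotropicRegion z ρ with hS
  set T : Set (ℂ × EuclideanSpace ℂ (Fin d)) := {p | ‖p.1‖ < ρ ∧ p.2 - p.1 • e ∈ S} with hT
  have hTm : MeasurableSet T := by
    refine IsOpen.measurableSet ?_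
    exact (isOpen_lt continuous_fst.norm continuous_const).inter
      ((isOpen_nonisotropicRegion z ρ).preimage
        (continuous_snd.sub (continuous_fst.smul continuous_const)))
  -- For fixed τ the slice of T is a translate of S.
  have h1 : (volume.prod volume) T = volume (Metric.ball (0 : ℂ) ρ) * volume S := by
    rw [Measure.prod_apply hTm]
    have : ∀ τ : ℂ, volume (Prod.mk τ ⁻¹' T) =
        (Metric.ball (0 : ℂ) ρ).indicator (fun _ => volume S) τ := by
      intro τ
      by_cases hτ : ‖τ‖ < ρ
      · rw [Set.indicator_of_mem (by simpa using hτ)]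
        have h3 : Prod.mk τ ⁻¹' T = (fun v => v - τ • e) ⁻¹' S := by
          ext v; simp [hT, hτ]
        rw [h3]
        simp only [sub_eq_add_neg]
        exact measure_preimage_add_right _ _ _
      · rw [Set.indicator_of_notMem (by simpa using hτ)]
        have h3 : Prod.mk τ ⁻¹' T = ∅ := by
          ext v; simp [hT, hτ]
        rw [h3, measure_empty]
    simp_rw [this]
    rw [lintegral_indicator measurableSet_ball, setLIntegral_const, mul_comm]
  -- For fixed v with |v| < ρ/2 the slice contains the disc of radius ρ² about ⟨e, v⟩: subtracting
  -- nearly the whole normal component of v leaves a vector of S.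
  have h2 : volume (Metric.ball (0 : EuclideanSpace ℂ (Fin d)) (ρ / 2)) *
      volume (Metric.ball (0 : ℂ) (ρ ^ 2)) ≤ (volume.prod volume) T := by
    rw [Measure.prod_apply_symm hTm, mul_comm, ← setLIntegral_const,
      ← lintegral_indicator measurableSet_ball]
    refine lintegral_mono fun v => ?_
    by_cases hv : v ∈ Metric.ball (0 : EuclideanSpace ℂ (Fin d)) (ρ / 2)
    swap
    · rw [Set.indicator_of_notMem hv]
      exact zero_le
    rw [Set.indicator_of_mem hv]
    rw [mem_ball_zero_iff] at hv
    rw [← Measure.addHaar_ball_center volume (inner ℂ e v) (ρ ^ 2)]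
    refine measure_mono fun τ hτ => ?_
    rw [mem_ball_iff_norm] at hτ
    have hev : ‖inner ℂ e v‖ ≤ ‖v‖ := by
      simpa [hen] using norm_inner_le_norm (𝕜 := ℂ) e v
    have hτn : ‖τ‖ < ρ := by
      have := norm_le_norm_add_norm_sub' τ (inner ℂ e v)
      linarith
    have hpar := norm_sub_inner_smul_le hen v
    refine ⟨hτn, ?_, ?_⟩
    · have : v - τ • e = (v - inner ℂ e v • e) - (τ - inner ℂ e v) • e := by
        rw [sub_smul]; abel
      simp only
      rw [this]
      refine (norm_sub_le _ _).trans_lt ?_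
      rw [norm_smul, hen]
      linarith
    · have : inner ℂ z (v - τ • e) = (‖z‖ : ℂ) * (inner ℂ e v - τ) := by
        conv_lhs => rw [hze]
        rw [inner_smul_left, inner_sub_right, inner_smul_right, inner_self_eq_norm_sq_to_K, hen]
        simp
      simp only
      rw [this, norm_mul, norm_sub_rev]
      have := mem_unitBall.1 hz
      simp only [Complex.norm_real, norm_norm]
      nlinarith [norm_nonneg (τ - inner ℂ e v), norm_nonneg z]
  rw [h1, volume_ball_eq _ (by positivity), Measure.addHaar_ball_of_pos _ _ hρ,
    Measure.addHaar_ball_of_pos _ _ (by positivity), Complex.finrank_real_complex] at h2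
  set V := volume (Metric.ball (0 : ℂ) 1) with hV
  have hV0 : V ≠ 0 := (Metric.measure_ball_pos _ _ one_pos).ne'
  have hVt : V ≠ ⊤ := measure_ball_lt_top.ne
  have hρe : ENNReal.ofReal (ρ ^ 2) ≠ 0 := by simpa using hρ.ne'
  rw [← ENNReal.mul_le_mul_iff_right (mul_ne_zero hρe hV0)
    (ENNReal.mul_ne_top ENNReal.ofReal_ne_top hVt)]
  refine le_trans (le_of_eq ?_) h2
  rw [ENNReal.ofReal_mul (by positivity), ENNReal.ofReal_pow (by positivity : 0 ≤ ρ ^ 2)]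
  ring

theorem Real.rpow_le_mul_rpow_of_le_of_le {x y K : ℝ} (hx : 0 < x) (hy : 0 < y) (hK : 1 ≤ K)
    (hxy : x ≤ K * y) (hyx : y ≤ K * x) (a : ℝ) : x ^ a ≤ K ^ |a| * y ^ a := by
  have hK0 : 0 < K := by linarith
  rcases le_total 0 a with ha | ha
  · rw [abs_of_nonneg ha, ← Real.mul_rpow hK0.le hy.le]
    exact Real.rpow_le_rpow hx.le hxy ha
  · rw [abs_of_nonpos ha, Real.rpow_neg hK0.le, ← Real.inv_rpow hK0.le,
      ← Real.mul_rpow (by positivity) hy.le]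
    refine Real.rpow_le_rpow_of_nonpos (by positivity) ?_ ha
    rw [inv_mul_le_iff₀ hK0]
    exact hyx

theorem ballWeight_le_mul {d : ℕ} {z w : EuclideanSpace ℂ (Fin d)} (hz : z ∈ unitBall d)
    (hw : w ∈ unitBall d) {K : ℝ} (hK : 1 ≤ K) (h1 : 1 - ‖z‖ ^ 2 ≤ K * (1 - ‖w‖ ^ 2))
    (h2 : 1 - ‖w‖ ^ 2 ≤ K * (1 - ‖z‖ ^ 2)) (a : ℝ) :
    ballWeight a z ≤ ENNReal.ofReal (K ^ |a|) * ballWeight a w := by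
  rw [ballWeight, ballWeight, ← ENNReal.ofReal_mul (by positivity)]
  exact ENNReal.ofReal_le_ofReal (Real.rpow_le_mul_rpow_of_le_of_le (one_sub_norm_sq_pos hz)
    (one_sub_norm_sq_pos hw) hK h1 h2 a)

theorem weightedEnergy_eq_lintegral {d : ℕ} (a : ℝ) (f : EuclideanSpace ℂ (Fin d) → ℂ) :
    weightedEnergy d a f =
      ∫⁻ z, (unitBall d).indicator (fun z => ‖f z‖ₑ ^ 2) z * ballWeight a z := by
  rw [weightedEnergy, ← lintegral_indicator (measurableSet_unitBall d)]
  refine lintegral_congr fun z => ?_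
  by_cases hz : z ∈ unitBall d <;> simp [hz]

/-- A holomorphic function with finite weighted energy grows at most at the rate dictated by the
reproducing kernel. -/
theorem IsHolo.exists_growth_bound {d : ℕ} {f : EuclideanSpace ℂ (Fin d) → ℂ} (hf : IsHolo d f)
    {a : ℝ} (hfa : weightedEnergy d a f < ⊤) :
    ∃ C : ℝ, 0 ≤ C ∧ ∀ z ∈ unitBall d, ‖f z‖ ^ 2 ≤ C * (1 - ‖z‖ ^ 2) ^ (-(a + d + 1)) := by
  set c : ENNReal := ENNReal.ofReal ((1 / 6) * (1 / 24) ^ d) * volume (unitBall d) with hc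
  have hc0 : c ≠ 0 := mul_ne_zero (by simp) (volume_unitBall_ne_zero d)
  have hct : c ≠ ⊤ := ENNReal.mul_ne_top ENNReal.ofReal_ne_top (volume_unitBall_ne_top d)
  have key : ∀ z ∈ unitBall d, ‖f z‖ₑ ^ 2 * c * ballWeight (a + d + 1) z ≤
      ENNReal.ofReal (2 ^ |a|) * weightedEnergy d a f := by
    intro z hz
    set δ := 1 - ‖z‖ ^ 2 with hδ
    have hδ0 : 0 < δ := one_sub_norm_sq_pos hz
    have hδ1 : δ ≤ 1 := by nlinarith [norm_nonneg z]
    -- For v in S, |z + v|² differs from |z|² by at most 2ρ² + ρ² = δ/2, so the weight is comparable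
    -- throughout z + S.
    set ρ := √(δ / 6) with hρ
    have hρ2 : ρ ^ 2 = δ / 6 := Real.sq_sqrt (by positivity)
    have hρ0 : 0 < ρ := Real.sqrt_pos.2 (by positivity)
    have hρh : ρ ≤ 1 / 2 := by nlinarith
    set S := nonisotropicRegion z ρ with hS
    have hSm : MeasurableSet S := (isOpen_nonisotropicRegion z ρ).measurableSet
    have hest : ∀ v ∈ S, δ / 2 ≤ 1 - ‖z + v‖ ^ 2 ∧ 1 - ‖z + v‖ ^ 2 ≤ 2 * δ := by
      rintro v ⟨h1, h2⟩
      have h3 := norm_add_sq (𝕜 := ℂ) z v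
      have h4 := (abs_le.1 (Complex.abs_re_le_norm (inner ℂ z v)))
      have h5 : ‖v‖ ^ 2 < ρ ^ 2 := by gcongr
      simp only [RCLike.re_to_complex] at h3
      constructor <;> nlinarith [norm_nonneg v]
    have hin : ∀ v ∈ S, z + v ∈ unitBall d := by
      intro v hv
      have := (hest v hv).1
      rw [mem_unitBall]
      nlinarith [norm_nonneg (z + v)]
    set G := (unitBall d).indicator fun z => ‖f z‖ₑ ^ 2 with hG
    have hGm : Measurable G := hf.measurable_indicator
    have hsub := hf.enorm_sq_mul_volume_le hSm (balanced_nonisotropicRegion z ρ) hin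
    have hvol := volume_nonisotropicRegion_ge hz hρ0 hρh
    have hcS : c * ballWeight (d + 1) z ≤ volume S := by
      refine le_trans (le_of_eq ?_) hvol
      rw [hc, mul_right_comm, ballWeight, ← ENNReal.ofReal_mul (by positivity)]
      congr 2
      rw [← hδ, div_pow ρ, pow_mul ρ, hρ2, pow_mul (2 : ℝ), div_pow δ, div_div, ← mul_pow]
      rw [show (d : ℝ) + 1 = ((d + 1 : ℕ) : ℝ) by push_cast; ring, Real.rpow_natCast, pow_succ]
      rw [div_pow, one_pow]
      norm_num
      ring
    have hz' : ballWeight (a + d + 1) z = ballWeight (d + 1) z * ballWeight a z := by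
      rw [ballWeight_mul _ _ hz]; congr 1; ring
    calc ‖f z‖ₑ ^ 2 * c * ballWeight (a + d + 1) z
        = ‖f z‖ₑ ^ 2 * (c * ballWeight (d + 1) z) * ballWeight a z := by rw [hz']; ring
      _ ≤ (∫⁻ v in S, G (z + v)) * ballWeight a z := by
        gcongr
        exact le_trans (by gcongr) hsub
      _ = ∫⁻ v in S, G (z + v) * ballWeight a z :=
        (lintegral_mul_const' _ _ (ballWeight_ne_top _ _)).symm
      _ ≤ ∫⁻ v in S, ENNReal.ofReal (2 ^ |a|) * (G (z + v) * ballWeight a (z + v)) := by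
        refine setLIntegral_mono' hSm fun v hv => ?_
        have h6 := hest v hv
        have := ballWeight_le_mul hz (hin v hv) (K := 2) (by norm_num) (by linarith)
          (by linarith) a
        calc G (z + v) * ballWeight a z
            ≤ G (z + v) * (ENNReal.ofReal (2 ^ |a|) * ballWeight a (z + v)) := by gcongr
          _ = _ := by ring
      _ = ENNReal.ofReal (2 ^ |a|) * ∫⁻ v in S, G (z + v) * ballWeight a (z + v) :=
        lintegral_const_mul' _ _ ENNReal.ofReal_ne_top
      _ ≤ ENNReal.ofReal (2 ^ |a|) * ∫⁻ v, G (z + v) * ballWeight a (z + v) := by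
        gcongr; exact Measure.restrict_le_self
      _ = ENNReal.ofReal (2 ^ |a|) * weightedEnergy d a f := by
        rw [lintegral_add_left_eq_self (fun v => G v * ballWeight a v), weightedEnergy_eq_lintegral]
  set W := ENNReal.ofReal (2 ^ |a|) * weightedEnergy d a f with hW
  have hWt : W ≠ ⊤ := ENNReal.mul_ne_top ENNReal.ofReal_ne_top hfa.ne
  refine ⟨W.toReal / c.toReal, by positivity, fun z hz => ?_⟩
  have h1 := ENNReal.toReal_mono hWt (key z hz)
  have hδ0 := one_sub_norm_sq_pos hz
  have hc' : 0 < c.toReal := ENNReal.toReal_pos hc0 hct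
  have hp : 0 < (1 - ‖z‖ ^ 2) ^ (a + d + 1) := by positivity
  rw [ENNReal.toReal_mul, ENNReal.toReal_mul, ENNReal.toReal_pow, toReal_enorm, ballWeight,
    ENNReal.toReal_ofReal hp.le] at h1
  rw [Real.rpow_neg hδ0.le, ← div_eq_mul_inv, le_div_iff₀ hp, le_div_iff₀ hc']
  linarith

/-! ### The number operator on weighted energies. -/

/-- Cauchy's estimate for f(z + tz) on |t| ≤ r = (1 - |z|)/4, where each value is controlled by the
L² mean over a ball of radius r. All these balls lie in the ball of radius 2r about z. -/
theorem IsHolo.enorm_numberOp_sq_mul_le {d : ℕ} {f : EuclideanSpace ℂ (Fin d) → ℂ}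
    (hf : IsHolo d f) {z : EuclideanSpace ℂ (Fin d)} (hz : z ∈ unitBall d) :
    ‖numberOp d f z‖ₑ ^ 2 *
        ENNReal.ofReal (((1 - ‖z‖) / 4) ^ 2 * ((1 - ‖z‖) / 4) ^ (2 * d)) * volume (unitBall d) ≤
      ∫⁻ w in Metric.ball z ((1 - ‖z‖) / 2), (unitBall d).indicator (fun z => ‖f z‖ₑ ^ 2) w := by
  have hz1 := mem_unitBall.1 hz
  set r := (1 - ‖z‖) / 4 with hr
  have hr0 : 0 < r := by rw [hr]; linarith
  set G := (unitBall d).indicator fun z => ‖f z‖ₑ ^ 2 with hG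
  set I := ∫⁻ w in Metric.ball z ((1 - ‖z‖) / 2), G w with hI
  have hGm : Measurable G := hf.measurable_indicator
  set V := volume (Metric.ball (0 : EuclideanSpace ℂ (Fin d)) r) with hV
  have hVeq : V = ENNReal.ofReal (r ^ (2 * d)) * volume (unitBall d) := volume_ball_eq _ hr0
  have hV0 : V ≠ 0 := (Metric.measure_ball_pos _ _ hr0).ne'
  have hVt : V ≠ ⊤ := measure_ball_lt_top.ne
  rw [ENNReal.ofReal_mul (by positivity), mul_assoc, mul_assoc, ← hVeq]
  have htz : ∀ t : ℂ, ‖t‖ ≤ r → ‖t • z‖ ≤ r := by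
    intro t ht
    rw [norm_smul]
    nlinarith [norm_nonneg z, norm_nonneg t]
  have hmem : ∀ t : ℂ, ‖t‖ ≤ r → ∀ v ∈ Metric.ball (0 : EuclideanSpace ℂ (Fin d)) r,
      z + t • z + v ∈ unitBall d := by
    intro t ht v hv
    rw [mem_ball_zero_iff] at hv
    have h1 := norm_add_le (z + t • z) v
    have h2 := norm_add_le z (t • z)
    rw [mem_unitBall]
    linarith [htz t ht]
  have hsub : ∀ t : ℂ, ‖t‖ ≤ r → ‖f (z + t • z)‖ₑ ^ 2 * V ≤ I := by
    intro t ht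
    refine (hf.enorm_sq_mul_volume_le measurableSet_ball (balanced_ball_zero) (hmem t ht)).trans ?_
    rw [hI, ← lintegral_indicator measurableSet_ball, ← lintegral_indicator measurableSet_ball,
      ← lintegral_add_left_eq_self (μ := volume)
        ((Metric.ball z ((1 - ‖z‖) / 2)).indicator fun w => G w) (z + t • z)]
    refine lintegral_mono fun v => ?_
    by_cases hv : v ∈ Metric.ball (0 : EuclideanSpace ℂ (Fin d)) r
    · have : z + t • z + v ∈ Metric.ball z ((1 - ‖z‖) / 2) := by
        rw [mem_ball_zero_iff] at hv
        rw [mem_ball_iff_norm, show z + t • z + v - z = t • z + v by abel]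
        have := norm_add_le (t • z) v
        linarith [htz t ht]
      rw [Set.indicator_of_mem hv, Set.indicator_of_mem this]
    · rw [Set.indicator_of_notMem hv]
      exact zero_le
  by_cases hIt : I = ⊤
  · rw [hIt]; exact le_top
  set A := (I / V).toReal with hA
  have hIV : I / V ≠ ⊤ := ENNReal.div_ne_top hIt hV0
  have hb : ∀ t : ℂ, ‖t‖ ≤ r → ‖f (z + t • z)‖ ≤ √A := by
    intro t ht
    refine Real.le_sqrt_of_sq_le ?_
    have := ENNReal.toReal_mono hIV ((ENNReal.le_div_iff_mul_le (Or.inl hV0) (Or.inl hVt)).2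
      (hsub t ht))
    rwa [ENNReal.toReal_pow, toReal_enorm] at this
  have h0 : z + (0 : ℂ) • z ∈ unitBall d := by simpa using hz
  have hder := hf.hasDerivAt_add_smul h0
  rw [zero_smul, add_zero] at hder
  have hdiff : DifferentiableOn ℂ (fun s : ℂ => f (z + s • z)) (Metric.closedBall 0 r) := by
    intro t ht
    have := hmem t (by simpa using ht) 0 (by simpa using hr0)
    rw [add_zero] at this
    exact (hf.hasDerivAt_add_smul this).differentiableAt.differentiableWithinAt
  have hN := Complex.norm_deriv_le_of_forall_mem_sphere_norm_le hr0
    (hdiff.mono Metric.closure_ball_subset_closedBall).diffContOnCl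
    (fun t ht => hb t (by simpa using (mem_sphere_iff_norm.1 ht).le))
  rw [hder.deriv, ← numberOp_eq_fderiv, le_div_iff₀ hr0] at hN
  have hN2 : ‖numberOp d f z‖ ^ 2 * r ^ 2 ≤ A := by
    rw [← mul_pow, ← Real.sq_sqrt (show 0 ≤ A from ENNReal.toReal_nonneg)]
    gcongr
  have hN3 := ENNReal.ofReal_le_ofReal hN2
  rw [ENNReal.ofReal_mul (by positivity), ENNReal.ofReal_pow (norm_nonneg _), ofReal_norm,
    hA, ENNReal.ofReal_toReal hIV] at hN3
  rw [← mul_assoc]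
  exact (ENNReal.le_div_iff_mul_le (Or.inl hV0) (Or.inl hVt)).1 hN3

/-- Each application of the number operator costs two powers of the weight. -/
theorem IsHolo.weightedEnergy_numberOp_lt_top {d : ℕ} {f : EuclideanSpace ℂ (Fin d) → ℂ}
    (hf : IsHolo d f) {a : ℝ} (hfa : weightedEnergy d a f < ⊤) :
    weightedEnergy d (a + 2) (numberOp d f) < ⊤ := by
  set G := (unitBall d).indicator fun z => ‖f z‖ₑ ^ 2 with hG
  have hGm : Measurable G := hf.measurable_indicator
  set V := volume (unitBall d) with hV
  have hV0 : V ≠ 0 := volume_unitBall_ne_zero d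
  have hVt : V ≠ ⊤ := volume_unitBall_ne_top d
  -- The local estimate uses up 2 + 2d of the exponent a + 2 and leaves b; the volume of the
  -- z-section at w later restores the missing 2d.
  set b : ℝ := a - 2 * d with hb
  set κ : ENNReal := ENNReal.ofReal ((1 / 8) ^ (2 + 2 * d)) with hκ
  have hκ0 : κ ≠ 0 := by simp [hκ]
  have hκt : κ ≠ ⊤ := ENNReal.ofReal_ne_top
  set T : Set (EuclideanSpace ℂ (Fin d) × EuclideanSpace ℂ (Fin d)) :=
    {p | ‖p.1‖ < 1 ∧ ‖p.2 - p.1‖ < (1 - ‖p.1‖) / 2} with hT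
  have hTm : MeasurableSet T :=
    ((isOpen_lt continuous_fst.norm continuous_const).inter
      (isOpen_lt (continuous_snd.sub continuous_fst).norm
        ((continuous_const.sub continuous_fst.norm).div_const 2))).measurableSet
  have hpt : ∀ z ∈ unitBall d, ‖numberOp d f z‖ₑ ^ 2 * ballWeight (a + 2) z * (κ * V) ≤
      ∫⁻ w, T.indicator (fun p => G p.2 * ballWeight b p.1) (z, w) := by
    intro z hz
    have hz1 := mem_unitBall.1 hz
    have h1 := hf.enorm_numberOp_sq_mul_le hz
    have hδ := one_sub_norm_sq_pos hz
    have hw : ballWeight (2 + 2 * d) z * κ ≤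
        ENNReal.ofReal (((1 - ‖z‖) / 4) ^ 2 * ((1 - ‖z‖) / 4) ^ (2 * d)) := by
      rw [ballWeight, hκ, ← ENNReal.ofReal_mul (by positivity), ← pow_add]
      refine ENNReal.ofReal_le_ofReal ?_
      rw [show (2 : ℝ) + 2 * d = ((2 + 2 * d : ℕ) : ℝ) by push_cast; ring, Real.rpow_natCast,
        ← mul_pow]
      have : (1 - ‖z‖ ^ 2) * (1 / 8) ≤ (1 - ‖z‖) / 4 := by nlinarith [norm_nonneg z]
      gcongr
    have hsplit : ballWeight (a + 2) z = ballWeight (2 + 2 * d) z * ballWeight b z := by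
      rw [ballWeight_mul _ _ hz]; congr 1; rw [hb]; ring
    calc ‖numberOp d f z‖ₑ ^ 2 * ballWeight (a + 2) z * (κ * V)
        = ‖numberOp d f z‖ₑ ^ 2 * (ballWeight (2 + 2 * d) z * κ) * V * ballWeight b z := by
          rw [hsplit]; ring
      _ ≤ (∫⁻ w in Metric.ball z ((1 - ‖z‖) / 2), G w) * ballWeight b z := by
          gcongr
          exact le_trans (by gcongr) h1
      _ = ∫⁻ w in Metric.ball z ((1 - ‖z‖) / 2), G w * ballWeight b z :=
          (lintegral_mul_const' _ _ (ballWeight_ne_top _ _)).symm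
      _ = _ := by
          rw [← lintegral_indicator measurableSet_ball]
          refine lintegral_congr fun w => ?_
          simp only [Set.indicator, hT, Set.mem_ofPred_eq, hz1, true_and, mem_ball_iff_norm]
  have hinner : ∀ w, ∫⁻ z, T.indicator (fun p => G p.2 * ballWeight b p.1) (z, w) ≤
      ENNReal.ofReal (4 ^ |b|) * V * (G w * ballWeight a w) := by
    intro w
    by_cases hw : w ∈ unitBall d
    · have hw1 := mem_unitBall.1 hw
      have hδw := one_sub_norm_sq_pos hw
      calc ∫⁻ z, T.indicator (fun p => G p.2 * ballWeight b p.1) (z, w)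
          ≤ ∫⁻ z, (Metric.ball w (1 - ‖w‖)).indicator
              (fun _ => G w * (ENNReal.ofReal (4 ^ |b|) * ballWeight b w)) z := by
            refine lintegral_mono fun z => ?_
            by_cases hzT : (z, w) ∈ T
            · rw [Set.indicator_of_mem hzT]
              obtain ⟨hz1, hzw⟩ := hzT
              simp only at hz1 hzw
              have h3 := norm_le_norm_add_norm_sub' w z
              have h4 := norm_le_norm_add_norm_sub' z w
              rw [norm_sub_rev] at h4
              rw [Set.indicator_of_mem (by rw [mem_ball_iff_norm, norm_sub_rev]; linarith)]
              gcongr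
              -- On T, 1 - |z| and 1 - |w| agree up to a factor 2, and 1 - |x|² lies between 1 - |x|
              -- and twice it; hence the 4.
              refine ballWeight_le_mul (mem_unitBall.2 hz1) hw (by norm_num) ?_ ?_ b
              · nlinarith [norm_nonneg z, norm_nonneg w]
              · nlinarith [norm_nonneg z, norm_nonneg w]
            · rw [Set.indicator_of_notMem hzT]
              exact zero_le
        _ = ENNReal.ofReal (4 ^ |b|) * V * (G w *
              (ENNReal.ofReal ((1 - ‖w‖) ^ (2 * d)) * ballWeight b w)) := by
            rw [lintegral_indicator measurableSet_ball, setLIntegral_const,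
              volume_ball_eq _ (by linarith)]
            ring
        _ ≤ _ := by
            have : a = ((2 * d : ℕ) : ℝ) + b := by rw [hb]; push_cast; ring
            rw [this, ← ballWeight_mul _ _ hw]
            gcongr
            rw [ballWeight, Real.rpow_natCast]
            refine ENNReal.ofReal_le_ofReal ?_
            have : 1 - ‖w‖ ≤ 1 - ‖w‖ ^ 2 := by nlinarith [norm_nonneg w]
            have : 0 ≤ 1 - ‖w‖ := by linarith
            gcongr
    · have : ∀ z, T.indicator (fun p => G p.2 * ballWeight b p.1) (z, w) = 0 := by
        intro z
        refine Set.indicator_apply_eq_zero.2 fun _ => ?_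
        simp [hG, hw]
      simp [this]
  have htot : weightedEnergy d (a + 2) (numberOp d f) * (κ * V) ≤
      ENNReal.ofReal (4 ^ |b|) * V * weightedEnergy d a f := by
    calc weightedEnergy d (a + 2) (numberOp d f) * (κ * V)
        = ∫⁻ z in unitBall d, ‖numberOp d f z‖ₑ ^ 2 * ballWeight (a + 2) z * (κ * V) :=
          (lintegral_mul_const' _ _ (ENNReal.mul_ne_top hκt hVt)).symm
      _ ≤ ∫⁻ z in unitBall d, ∫⁻ w, T.indicator (fun p => G p.2 * ballWeight b p.1) (z, w) :=
          setLIntegral_mono' (measurableSet_unitBall d) hpt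
      _ ≤ ∫⁻ z, ∫⁻ w, T.indicator (fun p => G p.2 * ballWeight b p.1) (z, w) :=
          setLIntegral_le_lintegral _ _
      _ = ∫⁻ w, ∫⁻ z, T.indicator (fun p => G p.2 * ballWeight b p.1) (z, w) := by
          refine lintegral_lintegral_swap (Measurable.aemeasurable ?_)
          exact ((hGm.comp measurable_snd).mul
            ((measurable_ballWeight b).comp measurable_fst)).indicator hTm
      _ ≤ ∫⁻ w, ENNReal.ofReal (4 ^ |b|) * V * (G w * ballWeight a w) := lintegral_mono hinner
      _ = _ := by
          rw [lintegral_const_mul' _ _ (ENNReal.mul_ne_top ENNReal.ofReal_ne_top hVt),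
            weightedEnergy_eq_lintegral]
  by_contra hcon
  rw [not_lt_top_iff] at hcon
  rw [hcon, ENNReal.top_mul (mul_ne_zero hκ0 hV0), top_le_iff] at htot
  exact ENNReal.mul_ne_top (ENNReal.mul_ne_top ENNReal.ofReal_ne_top hVt) hfa.ne htot

/-! ### Boundary growth and integration along rays. -/

/-- Polynomial growth of order `b` at the boundary of the ball. -/
def HasBoundaryGrowth (d : ℕ) (b : ℝ) (f : EuclideanSpace ℂ (Fin d) → ℂ) : Prop :=
  ∃ C : ℝ, 0 ≤ C ∧ ∀ z ∈ unitBall d, ‖f z‖ ≤ C * (1 - ‖z‖ ^ 2) ^ (-b)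

theorem IsHolo.hasBoundaryGrowth {d : ℕ} {f : EuclideanSpace ℂ (Fin d) → ℂ} (hf : IsHolo d f)
    {a : ℝ} (hfa : weightedEnergy d a f < ⊤) : HasBoundaryGrowth d ((a + d + 1) / 2) f := by
  obtain ⟨C, hC, h⟩ := hf.exists_growth_bound hfa
  refine ⟨√C, Real.sqrt_nonneg _, fun z hz => ?_⟩
  have hδ := one_sub_norm_sq_pos hz
  refine abs_le_of_sq_le_sq' ?_ (by positivity) |>.2
  refine (h z hz).trans_eq ?_
  rw [mul_pow, Real.sq_sqrt hC, ← Real.rpow_natCast (_ ^ _), ← Real.rpow_mul hδ.le]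
  congr 2
  push_cast
  ring

theorem real_smul_mem_unitBall {d : ℕ} {z : EuclideanSpace ℂ (Fin d)} (hz : z ∈ unitBall d)
    {t : ℝ} (h0 : 0 ≤ t) (h1 : t ≤ 1) : (t : ℂ) • z ∈ unitBall d :=
  smul_mem_unitBall hz (by simpa [abs_of_nonneg h0] using h1)

theorem norm_real_smul {d : ℕ} (z : EuclideanSpace ℂ (Fin d)) {t : ℝ} (h0 : 0 ≤ t) :
    ‖(t : ℂ) • z‖ = t * ‖z‖ := by
  rw [norm_smul]; simp [abs_of_nonneg h0]

theorem IsHolo.hasDerivAt_real_smul {d : ℕ} {f : EuclideanSpace ℂ (Fin d) → ℂ}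
    (hf : IsHolo d f) {z : EuclideanSpace ℂ (Fin d)} (hz : z ∈ unitBall d) {t : ℝ} (h0 : 0 < t)
    (h1 : t ≤ 1) :
    HasDerivAt (fun s : ℝ => f ((s : ℂ) • z)) ((t : ℂ)⁻¹ * numberOp d f ((t : ℂ) • z)) t := by
  have hmem : (0 : EuclideanSpace ℂ (Fin d)) + (t : ℂ) • z ∈ unitBall d := by
    simpa using real_smul_mem_unitBall hz h0.le h1
  have h := (hf.hasDerivAt_add_smul hmem).comp_ofReal
  simp only [zero_add] at h
  convert h using 1
  rw [numberOp_eq_fderiv, map_smul, smul_eq_mul, inv_mul_cancel_left₀]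
  exact_mod_cast h0.ne'

/-- The derivative of f(tz) in t is Nf(tz)/t, so f is recovered by integrating from t = 1/2 to 1. As
b > 0, the singularity at the endpoint dominates and one order is gained. -/
theorem IsHolo.hasBoundaryGrowth_of_numberOp {d : ℕ} {f : EuclideanSpace ℂ (Fin d) → ℂ}
    (hf : IsHolo d f) {b : ℝ} (hb : 0 < b) (h : HasBoundaryGrowth d (b + 1) (numberOp d f)) :
    HasBoundaryGrowth d b f := by
  obtain ⟨C, hC, hN⟩ := h
  obtain ⟨M, hM0, hM⟩ := hf.exists_bound_closedBall (R := 1 / 2) (by norm_num)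
  -- For t and |z| at least 1/2, 1/t ≤ 2 while 2t|z|² ≥ 1/4; the ratio 8 makes the derivative of the
  -- barrier dominate.
  set K : ℝ := 8 * C / b with hK
  have hK0 : 0 ≤ K := by positivity
  have hKb : K * b = 8 * C := by rw [hK]; field_simp
  refine ⟨M + K, by positivity, fun z hz => ?_⟩
  have hδ := one_sub_norm_sq_pos hz
  have hz1 := mem_unitBall.1 hz
  have hge1 : 1 ≤ (1 - ‖z‖ ^ 2) ^ (-b) :=
    Real.one_le_rpow_of_pos_of_le_one_of_nonpos hδ (by nlinarith [norm_nonneg z]) (by linarith)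
  by_cases hz2 : ‖z‖ ≤ 1 / 2
  · have := hM z hz2
    nlinarith
  push Not at hz2
  have hpos : ∀ t ∈ Set.Icc (1 / 2 : ℝ) 1, 0 < 1 - t ^ 2 * ‖z‖ ^ 2 := by
    rintro t ⟨ht0, ht1⟩
    have : t ^ 2 ≤ 1 := by nlinarith
    nlinarith [norm_nonneg z]
  have hB : ∀ t ∈ Set.Icc (1 / 2 : ℝ) 1, HasDerivAt
      (fun t : ℝ => M + K * (1 - t ^ 2 * ‖z‖ ^ 2) ^ (-b))
      (K * (-(2 * t * ‖z‖ ^ 2) * (-b) * (1 - t ^ 2 * ‖z‖ ^ 2) ^ (-b - 1))) t := by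
    intro t ht
    have h1 : HasDerivAt (fun t : ℝ => 1 - t ^ 2 * ‖z‖ ^ 2) (-(2 * t * ‖z‖ ^ 2)) t := by
      simpa using ((hasDerivAt_pow 2 t).mul_const (‖z‖ ^ 2)).const_sub 1
    exact ((h1.rpow_const (Or.inl (hpos t ht).ne')).const_mul K).const_add M
  have key := image_norm_le_of_norm_deriv_right_le_deriv_boundary' (a := 1 / 2) (b := 1)
    (f := fun s : ℝ => f ((s : ℂ) • z))
    (f' := fun t => (t : ℂ)⁻¹ * numberOp d f ((t : ℂ) • z))
    (B := fun t : ℝ => M + K * (1 - t ^ 2 * ‖z‖ ^ 2) ^ (-b))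
    (B' := fun t => K * (-(2 * t * ‖z‖ ^ 2) * (-b) * (1 - t ^ 2 * ‖z‖ ^ 2) ^ (-b - 1)))
    (fun t ht => (hf.hasDerivAt_real_smul hz (by linarith [ht.1]) ht.2).continuousAt.continuousWithinAt)
    (fun t ht => (hf.hasDerivAt_real_smul hz (by linarith [ht.1]) ht.2.le).hasDerivWithinAt)
    (by
      have h2 := hM (((1 / 2 : ℝ) : ℂ) • z) (by
        rw [norm_real_smul z (by norm_num)]; linarith)
      have h3 : 0 ≤ (1 - (1 / 2 : ℝ) ^ 2 * ‖z‖ ^ 2) ^ (-b) :=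
        Real.rpow_nonneg (hpos _ ⟨le_rfl, by norm_num⟩).le _
      have := mul_nonneg hK0 h3
      linarith)
    (fun t ht => (hB t ht).continuousAt.continuousWithinAt)
    (fun t ht => (hB t ⟨ht.1, ht.2.le⟩).hasDerivWithinAt)
    (by
      rintro t ⟨ht0, ht1⟩
      have ht : (0 : ℝ) < t := by linarith
      have h4 := hN _ (real_smul_mem_unitBall hz ht.le ht1.le)
      rw [norm_real_smul z ht.le, mul_pow, neg_add'] at h4
      rw [norm_mul, norm_inv, Complex.norm_real, Real.norm_of_nonneg ht.le]
      have hP : 0 ≤ (1 - t ^ 2 * ‖z‖ ^ 2) ^ (-b - 1) :=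
        Real.rpow_nonneg (hpos t ⟨ht0, ht1.le⟩).le _
      set P := (1 - t ^ 2 * ‖z‖ ^ 2) ^ (-b - 1) with hPd
      have h5 : t⁻¹ ≤ 2 := by
        rw [inv_le_comm₀ ht (by norm_num)]; linarith
      calc t⁻¹ * ‖numberOp d f ((t : ℂ) • z)‖ ≤ 2 * (C * P) := by gcongr
        _ ≤ (8 * C) * (2 * t * ‖z‖ ^ 2) * P := by
          have h6 : 1 / 4 ≤ 2 * t * ‖z‖ ^ 2 := by nlinarith
          have := mul_nonneg hC hP
          nlinarith
        _ = K * (-(2 * t * ‖z‖ ^ 2) * (-b) * P) := by rw [← hKb]; ring)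
    (x := 1) ⟨by norm_num, le_rfl⟩
  simp only [Complex.ofReal_one, one_smul, one_pow, one_mul] at key
  nlinarith

/-! ### Dilation averages and the Hardy inequality. -/

theorem lintegral_rpow_neg_le {ε : ℝ} (hε : 0 < ε) :
    ∃ K : ENNReal, K ≠ ⊤ ∧ ∀ δ : ℝ, 0 < δ →
      ∫⁻ t in Set.Ioc (1 / 2 : ℝ) 1, ENNReal.ofReal (((δ + 1 - t) / 2) ^ (-(1 + ε))) ≤
        K * ENNReal.ofReal (δ ^ (-ε)) := by
  refine ⟨ENNReal.ofReal ((2 : ℝ) ^ (1 + ε) * ε⁻¹), ENNReal.ofReal_ne_top, fun δ hδ => ?_⟩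
  have h0 : (0 : ℝ) ∉ Set.uIcc δ (δ + 1 - 1 / 2) := by
    rw [Set.uIcc_of_le (by linarith)]
    exact fun h => by linarith [h.1]
  have hI : IntervalIntegrable (fun x : ℝ => x ^ (-(1 + ε))) volume δ (δ + 1 - 1 / 2) :=
    intervalIntegral.intervalIntegrable_rpow (Or.inr h0)
  have hI2 : IntervalIntegrable (fun t : ℝ => (δ + 1 - t) ^ (-(1 + ε))) volume (1 / 2) 1 := by
    have := hI.symm.comp_sub_left (δ + 1)
    simpa using this
  have hval : ∫ t in (1 / 2 : ℝ)..1, (δ + 1 - t) ^ (-(1 + ε)) ≤ ε⁻¹ * δ ^ (-ε) := by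
    rw [intervalIntegral.integral_comp_sub_left (fun x : ℝ => x ^ (-(1 + ε))) (δ + 1),
      show δ + 1 - 1 = δ by ring, integral_rpow (Or.inr ⟨by linarith, h0⟩)]
    rw [show -(1 + ε) + 1 = -ε by ring, div_neg, ← neg_div, neg_sub, div_eq_inv_mul]
    gcongr
    have : 0 ≤ (δ + 1 - 1 / 2) ^ (-ε) := Real.rpow_nonneg (by linarith) _
    linarith
  have hpos : ∀ t ∈ Set.Ioc (1 / 2 : ℝ) 1, 0 < δ + 1 - t := fun t ht => by linarith [ht.2]
  calc ∫⁻ t in Set.Ioc (1 / 2 : ℝ) 1, ENNReal.ofReal (((δ + 1 - t) / 2) ^ (-(1 + ε)))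
      = ∫⁻ t in Set.Ioc (1 / 2 : ℝ) 1, ENNReal.ofReal ((2 : ℝ) ^ (1 + ε)) *
          ENNReal.ofReal ((δ + 1 - t) ^ (-(1 + ε))) := by
        refine setLIntegral_congr_fun measurableSet_Ioc fun t ht => ?_
        have := hpos t ht
        rw [← ENNReal.ofReal_mul (by positivity), Real.div_rpow this.le (by norm_num),
          Real.rpow_neg (by norm_num : (0 : ℝ) ≤ 2), div_inv_eq_mul, mul_comm]
    _ = ENNReal.ofReal ((2 : ℝ) ^ (1 + ε)) *
          ENNReal.ofReal (∫ t in (1 / 2 : ℝ)..1, (δ + 1 - t) ^ (-(1 + ε))) := by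
        rw [lintegral_const_mul' _ _ ENNReal.ofReal_ne_top,
          intervalIntegral.integral_of_le (by norm_num), ofReal_integral_eq_lintegral_ofReal]
        · exact (intervalIntegrable_iff_integrableOn_Ioc_of_le (by norm_num)).1 hI2
        · exact (ae_restrict_iff' measurableSet_Ioc).2 (Filter.Eventually.of_forall
            fun t ht => Real.rpow_nonneg (hpos t ht).le _)
    _ ≤ _ := by
        rw [← ENNReal.ofReal_mul (by positivity), ← ENNReal.ofReal_mul (by positivity), mul_assoc]
        gcongr

theorem lintegral_dilation_weight_le {β : ℝ} (hβ : -1 < β) :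
    ∃ K : ENNReal, K ≠ ⊤ ∧ ∀ s : ℝ, 0 ≤ s → s < 1 →
      ∫⁻ t in Set.Ioc (1 / 2 : ℝ) 1 ∩ Set.Ioi s, ENNReal.ofReal ((1 - (t⁻¹ * s) ^ 2) ^ β) ≤
        K * ENNReal.ofReal ((1 - s ^ 2) ^ (β + 1)) := by
  refine ⟨ENNReal.ofReal ((8 : ℝ) ^ |β| * (β + 1)⁻¹), ENNReal.ofReal_ne_top, fun s hs0 hs1 => ?_⟩
  have hβ1 : 0 < β + 1 := by linarith
  have hI : IntervalIntegrable (fun x : ℝ => x ^ β) volume 0 (1 - s) :=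
    intervalIntegral.intervalIntegrable_rpow' hβ
  have hI2 : IntervalIntegrable (fun t : ℝ => (t - s) ^ β) volume s 1 := by
    have := hI.comp_sub_right s
    simpa using this
  have hval : ∫ t in s..1, (t - s) ^ β = (1 - s) ^ (β + 1) * (β + 1)⁻¹ := by
    rw [intervalIntegral.integral_comp_sub_right (fun x : ℝ => x ^ β) s,
      integral_rpow (Or.inl hβ), sub_self, Real.zero_rpow hβ1.ne', sub_zero, div_eq_mul_inv]
  calc ∫⁻ t in Set.Ioc (1 / 2 : ℝ) 1 ∩ Set.Ioi s, ENNReal.ofReal ((1 - (t⁻¹ * s) ^ 2) ^ β)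
      ≤ ∫⁻ t in Set.Ioc (1 / 2 : ℝ) 1 ∩ Set.Ioi s,
          ENNReal.ofReal ((8 : ℝ) ^ |β|) * ENNReal.ofReal ((t - s) ^ β) := by
        refine setLIntegral_mono' (measurableSet_Ioc.inter measurableSet_Ioi) ?_
        rintro t ⟨⟨ht0, ht1⟩, hts⟩
        have ht : 0 < t := by linarith
        have hts' : 0 < t - s := sub_pos.2 hts
        -- The second factor is bounded above and below, so only the integrable singularity (t -
        -- s)^β remains.
        have hid : 1 - (t⁻¹ * s) ^ 2 = (t - s) * ((t + s) / t ^ 2) := by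
          field_simp
          ring
        have hlow : 1 ≤ (t + s) / t ^ 2 := by
          rw [le_div_iff₀ (by positivity)]; nlinarith
        have hup : (t + s) / t ^ 2 ≤ 8 := by
          rw [div_le_iff₀ (by positivity)]
          have : s < t := hts
          nlinarith
        rw [← ENNReal.ofReal_mul (by positivity)]
        refine ENNReal.ofReal_le_ofReal
          (Real.rpow_le_mul_rpow_of_le_of_le ?_ hts' (by norm_num) ?_ ?_ β)
        · rw [hid]; positivity
        · rw [hid]; nlinarith
        · rw [hid]; nlinarith
    _ ≤ ∫⁻ t in Set.Ioc s 1,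
          ENNReal.ofReal ((8 : ℝ) ^ |β|) * ENNReal.ofReal ((t - s) ^ β) :=
        lintegral_mono_set fun t ht => ⟨ht.2, ht.1.2⟩
    _ = ENNReal.ofReal ((8 : ℝ) ^ |β|) * ENNReal.ofReal (∫ t in s..1, (t - s) ^ β) := by
        rw [lintegral_const_mul' _ _ ENNReal.ofReal_ne_top,
          intervalIntegral.integral_of_le hs1.le, ofReal_integral_eq_lintegral_ofReal]
        · exact (intervalIntegrable_iff_integrableOn_Ioc_of_le hs1.le).1 hI2
        · exact (ae_restrict_iff' measurableSet_Ioc).2 (Filter.Eventually.of_forall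
            fun t ht => Real.rpow_nonneg (by linarith [ht.1]) _)
    _ ≤ _ := by
        rw [hval, ← ENNReal.ofReal_mul (by positivity), ← ENNReal.ofReal_mul (by positivity)]
        refine ENNReal.ofReal_le_ofReal ?_
        have : (1 - s) ^ (β + 1) ≤ (1 - s ^ 2) ^ (β + 1) :=
          Real.rpow_le_rpow (by linarith) (by nlinarith) hβ1.le
        calc (8 : ℝ) ^ |β| * ((1 - s) ^ (β + 1) * (β + 1)⁻¹)
            = (8 : ℝ) ^ |β| * (β + 1)⁻¹ * (1 - s) ^ (β + 1) := by ring
          _ ≤ _ := by gcongr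

theorem lintegral_comp_real_smul {d : ℕ} {F : EuclideanSpace ℂ (Fin d) → ENNReal}
    (hF : Measurable F) {t : ℝ} (ht : 0 < t) :
    ∫⁻ z, F ((t : ℂ) • z) = ENNReal.ofReal ((t ^ (2 * d))⁻¹) * ∫⁻ w, F w := by
  have h := Measure.map_addHaar_smul (volume : Measure (EuclideanSpace ℂ (Fin d))) ht.ne'
  rw [finrank_real_euclideanSpace, abs_of_pos (by positivity)] at h
  have hm : Measurable fun z : EuclideanSpace ℂ (Fin d) => t • z := measurable_const_smul t
  calc ∫⁻ z, F ((t : ℂ) • z) = ∫⁻ z, F (t • z) := rfl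
    _ = ∫⁻ w, F w ∂(Measure.map (fun z : EuclideanSpace ℂ (Fin d) => t • z) volume) :=
        (lintegral_map hF hm).symm
    _ = _ := by rw [h, lintegral_smul_measure, smul_eq_mul]

/-- Averaging over dilations gains one power of the weight. -/
theorem exists_lintegral_dilation_le (d : ℕ) {β : ℝ} (hβ : -1 < β) :
    ∃ K : ENNReal, K ≠ ⊤ ∧ ∀ G : EuclideanSpace ℂ (Fin d) → ENNReal, Measurable G →
      ∫⁻ z in unitBall d, ballWeight β z * ∫⁻ t in Set.Ioc (1 / 2 : ℝ) 1, G ((t : ℂ) • z) ≤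
        K * ∫⁻ w in unitBall d, G w * ballWeight (β + 1) w := by
  obtain ⟨K, hK, hKb⟩ := lintegral_dilation_weight_le hβ
  refine ⟨ENNReal.ofReal (2 ^ (2 * d)) * K, ENNReal.mul_ne_top ENNReal.ofReal_ne_top hK,
    fun G hG => ?_⟩
  set P : EuclideanSpace ℂ (Fin d) → ENNReal := (unitBall d).indicator (ballWeight β) with hP
  have hPm : Measurable P := (measurable_ballWeight β).indicator (measurableSet_unitBall d)
  have hsm : Measurable fun p : EuclideanSpace ℂ (Fin d) × ℝ => (p.2 : ℂ) • p.1 :=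
    ((Complex.continuous_ofReal.comp continuous_snd).smul continuous_fst).measurable
  have hsm2 : Measurable fun p : ℝ × EuclideanSpace ℂ (Fin d) => ((p.1⁻¹ : ℝ) : ℂ) • p.2 :=
    (Complex.measurable_ofReal.comp measurable_fst.inv).smul measurable_snd
  have hinner : ∀ w, ∫⁻ t in Set.Ioc (1 / 2 : ℝ) 1, G w * P (((t⁻¹ : ℝ) : ℂ) • w) ≤
      (unitBall d).indicator (fun w => K * (G w * ballWeight (β + 1) w)) w := by
    intro w
    by_cases hw : w ∈ unitBall d
    · rw [Set.indicator_of_mem hw]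
      have hw1 := mem_unitBall.1 hw
      have hPm' : Measurable fun t : ℝ => P (((t⁻¹ : ℝ) : ℂ) • w) :=
        hPm.comp (hsm2.comp (measurable_id.prodMk measurable_const))
      rw [lintegral_const_mul _ hPm']
      have : ∫⁻ t in Set.Ioc (1 / 2 : ℝ) 1, P (((t⁻¹ : ℝ) : ℂ) • w) ≤
          ∫⁻ t in Set.Ioc (1 / 2 : ℝ) 1 ∩ Set.Ioi ‖w‖,
            ENNReal.ofReal ((1 - (t⁻¹ * ‖w‖) ^ 2) ^ β) := by
        rw [← lintegral_indicator measurableSet_Ioc,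
          ← lintegral_indicator (measurableSet_Ioc.inter measurableSet_Ioi)]
        refine lintegral_mono fun t => ?_
        by_cases ht : t ∈ Set.Ioc (1 / 2 : ℝ) 1
        · rw [Set.indicator_of_mem ht]
          have ht0 : 0 < t := by linarith [ht.1]
          by_cases htw : ‖w‖ < t
          · rw [Set.indicator_of_mem (Set.mem_inter ht (Set.mem_Ioi.2 htw))]
            refine (Set.indicator_le_self _ _ _).trans ?_
            rw [ballWeight, norm_real_smul w (inv_nonneg.2 ht0.le)]
          · have hn : ((t⁻¹ : ℝ) : ℂ) • w ∉ unitBall d := by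
              rw [mem_unitBall, norm_real_smul w (inv_nonneg.2 ht0.le), inv_mul_lt_iff₀ ht0,
                mul_one]
              exact htw
            rw [hP, Set.indicator_of_notMem hn]
            exact zero_le
        · rw [Set.indicator_of_notMem ht]
          exact zero_le
      calc G w * ∫⁻ t in Set.Ioc (1 / 2 : ℝ) 1, P (((t⁻¹ : ℝ) : ℂ) • w)
          ≤ G w * (K * ballWeight (β + 1) w) := by
            gcongr
            exact this.trans (hKb _ (norm_nonneg w) hw1)
        _ = K * (G w * ballWeight (β + 1) w) := by ring
    · rw [Set.indicator_of_notMem hw, nonpos_iff_eq_zero]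
      refine (setLIntegral_congr_fun measurableSet_Ioc fun t ht => ?_).trans lintegral_zero
      have ht0 : 0 < t := by linarith [ht.1]
      have hn : ((t⁻¹ : ℝ) : ℂ) • w ∉ unitBall d := by
        rw [mem_unitBall, norm_real_smul w (inv_nonneg.2 ht0.le), inv_mul_lt_iff₀ ht0, mul_one]
        rw [mem_unitBall] at hw
        linarith [ht.2]
      rw [hP, Set.indicator_of_notMem hn, mul_zero]
  calc ∫⁻ z in unitBall d, ballWeight β z * ∫⁻ t in Set.Ioc (1 / 2 : ℝ) 1, G ((t : ℂ) • z)
      = ∫⁻ z, ∫⁻ t in Set.Ioc (1 / 2 : ℝ) 1, P z * G ((t : ℂ) • z) := by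
        rw [← lintegral_indicator (measurableSet_unitBall d)]
        refine lintegral_congr fun z => ?_
        have hGz : Measurable fun t : ℝ => G ((t : ℂ) • z) :=
          hG.comp (hsm.comp (measurable_const.prodMk measurable_id))
        rw [lintegral_const_mul _ hGz]
        by_cases hz : z ∈ unitBall d <;> simp [hP, hz]
    _ = ∫⁻ t in Set.Ioc (1 / 2 : ℝ) 1, ∫⁻ z, P z * G ((t : ℂ) • z) :=
        lintegral_lintegral_swap ((hPm.comp measurable_fst).mul (hG.comp hsm)).aemeasurable
    _ ≤ ∫⁻ t in Set.Ioc (1 / 2 : ℝ) 1, ENNReal.ofReal (2 ^ (2 * d)) *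
          ∫⁻ w, G w * P (((t⁻¹ : ℝ) : ℂ) • w) := by
        refine setLIntegral_mono' measurableSet_Ioc fun t ht => ?_
        have ht0 : 0 < t := by linarith [ht.1]
        have hFm : Measurable fun w => G w * P (((t⁻¹ : ℝ) : ℂ) • w) :=
          hG.mul (hPm.comp (hsm2.comp (measurable_const.prodMk measurable_id)))
        have h1 := lintegral_comp_real_smul hFm ht0
        have h2 : ∀ z : EuclideanSpace ℂ (Fin d), ((t⁻¹ : ℝ) : ℂ) • (t : ℂ) • z = z := by
          intro z
          rw [smul_smul, ← Complex.ofReal_mul, inv_mul_cancel₀ ht0.ne']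
          simp
        simp only [h2] at h1
        simp only [mul_comm (P _)]
        rw [h1]
        gcongr
        rw [← inv_pow]
        have : t⁻¹ ≤ 2 := by
          rw [inv_le_comm₀ ht0 (by norm_num)]; linarith [ht.1]
        gcongr
    _ = ENNReal.ofReal (2 ^ (2 * d)) * ∫⁻ w, ∫⁻ t in Set.Ioc (1 / 2 : ℝ) 1,
          G w * P (((t⁻¹ : ℝ) : ℂ) • w) := by
        rw [lintegral_const_mul' _ _ ENNReal.ofReal_ne_top, lintegral_lintegral_swap]
        exact ((hG.comp measurable_snd).mul (hPm.comp hsm2)).aemeasurable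
    _ ≤ ENNReal.ofReal (2 ^ (2 * d)) * ∫⁻ w,
          (unitBall d).indicator (fun w => K * (G w * ballWeight (β + 1) w)) w := by
        gcongr with w
        exact hinner w
    _ = _ := by
        rw [lintegral_indicator (measurableSet_unitBall d), lintegral_const_mul' _ _ hK, mul_assoc]

/-- Averaging the constant 1 over dilations bounds this integral by that of the weight with exponent
β + 1 > 0, which is at most 1. -/
theorem lintegral_ballWeight_lt_top (d : ℕ) {β : ℝ} (hβ : -1 < β) :
    ∫⁻ z in unitBall d, (ballWeight β z : ENNReal) < ⊤ := by
  obtain ⟨K, hK, h⟩ := exists_lintegral_dilation_le d hβ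
  have h1 := h (fun _ => 1) measurable_const
  simp only [one_mul, setLIntegral_const, Real.volume_Ioc] at h1
  have hc : ENNReal.ofReal (1 - 1 / 2) ≠ 0 := by simp; norm_num
  rw [lintegral_mul_const' _ _ ENNReal.ofReal_ne_top] at h1
  have h2 : ∫⁻ w in unitBall d, (ballWeight (β + 1) w : ENNReal) ≤ volume (unitBall d) := by
    calc ∫⁻ w in unitBall d, (ballWeight (β + 1) w : ENNReal) ≤ ∫⁻ _ in unitBall d, 1 := by
          refine setLIntegral_mono' (measurableSet_unitBall d) fun w hw => ?_
          rw [← ballWeight_zero w]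
          exact ballWeight_anti (by linarith) hw
      _ = _ := by simp
  by_contra hcon
  rw [not_lt_top_iff] at hcon
  rw [hcon, ENNReal.top_mul hc, top_le_iff] at h1
  exact ENNReal.mul_ne_top hK (ne_top_of_le_ne_top (volume_unitBall_ne_top d) h2) h1

theorem lintegral_dilation_ballWeight_le {ε : ℝ} (hε : 0 < ε) :
    ∃ K : ENNReal, K ≠ ⊤ ∧ ∀ (d : ℕ), ∀ z ∈ unitBall d,
      ∫⁻ t in Set.Ioc (1 / 2 : ℝ) 1, ballWeight (-(1 + ε)) ((t : ℂ) • z) ≤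
        K * ballWeight (-ε) z := by
  obtain ⟨K, hK, h⟩ := lintegral_rpow_neg_le hε
  refine ⟨K, hK, fun d z hz => ?_⟩
  have hδ := one_sub_norm_sq_pos hz
  refine le_trans (setLIntegral_mono' measurableSet_Ioc fun t ht => ?_) (h _ hδ)
  have ht0 : 0 < t := by linarith [ht.1]
  rw [ballWeight, norm_real_smul z ht0.le, mul_pow]
  refine ENNReal.ofReal_le_ofReal (Real.rpow_le_rpow_of_nonpos ?_ ?_ (by linarith))
  · linarith [ht.2]
  -- 1 - t²|z|² is at least 1 - t and at least δ, hence at least their mean.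
  · have h1 : t ^ 2 ≤ t := by nlinarith [ht.2]
    have h2 : t ^ 2 * ‖z‖ ^ 2 ≤ t ^ 2 := by nlinarith [sq_nonneg t, norm_nonneg z]
    have h3 : t ^ 2 * ‖z‖ ^ 2 ≤ ‖z‖ ^ 2 := by nlinarith [ht.2, sq_nonneg ‖z‖]
    linarith

/-- The fundamental theorem of calculus on the ray from z/2 to z, then Cauchy–Schwarz with the
weight of exponent c split off. The free exponent c lets both resulting integrals be controlled. -/
theorem IsHolo.enorm_sq_le_dilation {d : ℕ} {f : EuclideanSpace ℂ (Fin d) → ℂ} (hf : IsHolo d f)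
    {z : EuclideanSpace ℂ (Fin d)} (hz : z ∈ unitBall d) (c : ℝ) :
    ‖f z‖ₑ ^ 2 ≤ 2 * ‖f (((1 / 2 : ℝ) : ℂ) • z)‖ₑ ^ 2 + 8 *
      ((∫⁻ t in Set.Ioc (1 / 2 : ℝ) 1,
          (unitBall d).indicator (fun w => ‖numberOp d f w‖ₑ ^ 2) ((t : ℂ) • z) *
            ballWeight c ((t : ℂ) • z)) *
        ∫⁻ t in Set.Ioc (1 / 2 : ℝ) 1, ballWeight (-c) ((t : ℂ) • z)) := by
  have hN := hf.holo_numberOp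
  have hder : ∀ t ∈ Set.uIcc (1 / 2 : ℝ) 1, HasDerivAt (fun s : ℝ => f ((s : ℂ) • z))
      ((t : ℂ)⁻¹ * numberOp d f ((t : ℂ) • z)) t := by
    intro t ht
    rw [Set.uIcc_of_le (by norm_num)] at ht
    exact hf.hasDerivAt_real_smul hz (by linarith [ht.1]) ht.2
  have hcont : ContinuousOn (fun t : ℝ => (t : ℂ)⁻¹ * numberOp d f ((t : ℂ) • z))
      (Set.uIcc (1 / 2 : ℝ) 1) := by
    rw [Set.uIcc_of_le (by norm_num)]
    refine ContinuousOn.mul ?_ ?_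
    · refine ContinuousOn.inv₀ Complex.continuous_ofReal.continuousOn fun t ht => ?_
      have : t ≠ 0 := by linarith [ht.1]
      exact_mod_cast this
    · refine (DifferentiableOn.continuousOn hN).comp
        (Complex.continuous_ofReal.smul continuous_const).continuousOn fun t ht => ?_
      exact real_smul_mem_unitBall hz (by linarith [ht.1]) ht.2
  have hftc := intervalIntegral.integral_eq_sub_of_hasDerivAt hder hcont.intervalIntegrable
  rw [intervalIntegral.integral_of_le (by norm_num)] at hftc
  simp only [Complex.ofReal_one, one_smul] at hftc
  set G : EuclideanSpace ℂ (Fin d) → ENNReal :=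
    (unitBall d).indicator fun w => ‖numberOp d f w‖ₑ ^ 2 with hG
  have hGm : Measurable G := hN.measurable_indicator
  have hsm : Measurable fun t : ℝ => (t : ℂ) • z :=
    (Complex.continuous_ofReal.smul continuous_const).measurable
  set A : ℝ → ENNReal := fun t => G ((t : ℂ) • z) * ballWeight c ((t : ℂ) • z) with hA
  set B : ℝ → ENNReal := fun t => ballWeight (-c) ((t : ℂ) • z) with hB
  have hAm : Measurable A := (hGm.comp hsm).mul ((measurable_ballWeight c).comp hsm)
  have hBm : Measurable B := (measurable_ballWeight (-c)).comp hsm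
  have hdiff : ‖f z - f (((1 / 2 : ℝ) : ℂ) • z)‖ₑ ≤
      2 * ∫⁻ t in Set.Ioc (1 / 2 : ℝ) 1, A t ^ (1 / 2 : ℝ) * B t ^ (1 / 2 : ℝ) := by
    rw [← hftc, ← lintegral_const_mul' _ _ (by simp)]
    refine (enorm_integral_le_lintegral_enorm _).trans
      (setLIntegral_mono' measurableSet_Ioc fun t ht => ?_)
    have ht0 : 0 < t := by linarith [ht.1]
    have hmem := real_smul_mem_unitBall hz ht0.le ht.2
    have hAB : A t ^ (1 / 2 : ℝ) * B t ^ (1 / 2 : ℝ) = ‖numberOp d f ((t : ℂ) • z)‖ₑ := by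
      rw [← ENNReal.mul_rpow_of_nonneg _ _ (by norm_num), hA, hB]
      simp only
      rw [mul_assoc, ballWeight_mul _ _ hmem, add_neg_cancel, ballWeight_zero, mul_one, hG,
        Set.indicator_of_mem hmem, ← ENNReal.rpow_natCast, ← ENNReal.rpow_mul]
      simp
    rw [hAB, enorm_mul]
    gcongr
    rw [← ofReal_norm, norm_inv, Complex.norm_real, Real.norm_of_nonneg ht0.le]
    refine ENNReal.ofReal_le_of_le_toReal ?_
    rw [ENNReal.toReal_ofNat, inv_le_comm₀ ht0 (by norm_num)]
    linarith [ht.1]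
  have hcs : (∫⁻ t in Set.Ioc (1 / 2 : ℝ) 1, A t ^ (1 / 2 : ℝ) * B t ^ (1 / 2 : ℝ)) ^ 2 ≤
      (∫⁻ t in Set.Ioc (1 / 2 : ℝ) 1, A t) * ∫⁻ t in Set.Ioc (1 / 2 : ℝ) 1, B t := by
    have h1 := ENNReal.lintegral_mul_le_Lp_mul_Lq (volume.restrict (Set.Ioc (1 / 2 : ℝ) 1))
      Real.HolderConjugate.two_two (hAm.pow_const (1 / 2 : ℝ)).aemeasurable
      (hBm.pow_const (1 / 2 : ℝ)).aemeasurable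
    have h2 : ∀ x : ENNReal, (x ^ (1 / 2 : ℝ)) ^ (2 : ℝ) = x := by
      intro x; rw [← ENNReal.rpow_mul]; simp
    simp only [Pi.mul_apply, h2] at h1
    calc _ ≤ ((∫⁻ t in Set.Ioc (1 / 2 : ℝ) 1, A t) ^ (1 / 2 : ℝ) *
          (∫⁻ t in Set.Ioc (1 / 2 : ℝ) 1, B t) ^ (1 / 2 : ℝ)) ^ 2 := by gcongr
      _ = _ := by
        rw [← ENNReal.rpow_natCast, ENNReal.mul_rpow_of_nonneg _ _ (by positivity)]
        push_cast
        rw [h2, h2]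
  set p := f (((1 / 2 : ℝ) : ℂ) • z) with hp
  have hsq : ‖f z‖ₑ ^ 2 ≤ 2 * (‖p‖ₑ ^ 2 + ‖f z - p‖ₑ ^ 2) := by
    have := add_sq_le (a := ‖p‖₊) (b := ‖f z - p‖₊)
    calc ‖f z‖ₑ ^ 2 = ‖p + (f z - p)‖ₑ ^ 2 := by rw [add_sub_cancel]
      _ ≤ (‖p‖ₑ + ‖f z - p‖ₑ) ^ 2 := by gcongr; exact enorm_add_le _ _
      _ ≤ _ := by
        simp only [enorm_eq_nnnorm]
        exact_mod_cast this
  calc ‖f z‖ₑ ^ 2 ≤ 2 * (‖p‖ₑ ^ 2 + ‖f z - p‖ₑ ^ 2) := hsq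
    _ ≤ 2 * (‖p‖ₑ ^ 2 + (2 * ∫⁻ t in Set.Ioc (1 / 2 : ℝ) 1,
          A t ^ (1 / 2 : ℝ) * B t ^ (1 / 2 : ℝ)) ^ 2) := by gcongr
    _ = 2 * ‖p‖ₑ ^ 2 + 8 * (∫⁻ t in Set.Ioc (1 / 2 : ℝ) 1,
          A t ^ (1 / 2 : ℝ) * B t ^ (1 / 2 : ℝ)) ^ 2 := by ring
    _ ≤ _ := by gcongr

/-- A weighted Hardy inequality for the number operator. -/
theorem IsHolo.weightedEnergy_lt_top_of_numberOp {d : ℕ} {f : EuclideanSpace ℂ (Fin d) → ℂ}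
    (hf : IsHolo d f) {a : ℝ} (ha : -1 < a) (h : weightedEnergy d (a + 2) (numberOp d f) < ⊤) :
    weightedEnergy d a f < ⊤ := by
  -- With c = 1 + ε the negative weight integrates to exponent -ε, leaving a - ε = (a - 1)/2 > -1,
  -- to which dilation averaging applies. The final exponent is (1 + ε) + (a - ε + 1) = a + 2.
  set ε : ℝ := (a + 1) / 2 with hε
  have hε0 : 0 < ε := by rw [hε]; linarith
  obtain ⟨K₁, hK₁, h₁⟩ := lintegral_dilation_ballWeight_le hε0
  obtain ⟨K₂, hK₂, h₂⟩ := exists_lintegral_dilation_le d (β := a - ε) (by rw [hε]; linarith)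
  obtain ⟨M, hM0, hM⟩ := hf.exists_bound_closedBall (R := 1 / 2) (by norm_num)
  have hN := hf.holo_numberOp
  set G : EuclideanSpace ℂ (Fin d) → ENNReal := fun w =>
    (unitBall d).indicator (fun w => ‖numberOp d f w‖ₑ ^ 2) w * ballWeight (1 + ε) w with hG
  have hGm : Measurable G := hN.measurable_indicator.mul (measurable_ballWeight _)
  have hsm : Measurable fun p : EuclideanSpace ℂ (Fin d) × ℝ => (p.2 : ℂ) • p.1 :=
    ((Complex.continuous_ofReal.comp continuous_snd).smul continuous_fst).measurable
  have hpt : ∀ z ∈ unitBall d, ‖f z‖ₑ ^ 2 * ballWeight a z ≤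
      2 * ENNReal.ofReal M ^ 2 * ballWeight a z + 8 * K₁ *
        (ballWeight (a - ε) z * ∫⁻ t in Set.Ioc (1 / 2 : ℝ) 1, G ((t : ℂ) • z)) := by
    intro z hz
    have hz1 := mem_unitBall.1 hz
    have h3 := hf.enorm_sq_le_dilation hz (1 + ε)
    have h4 : ‖f (((1 / 2 : ℝ) : ℂ) • z)‖ₑ ≤ ENNReal.ofReal M := by
      rw [← ofReal_norm]
      refine ENNReal.ofReal_le_ofReal (hM _ ?_)
      rw [norm_real_smul z (by norm_num)]
      linarith
    calc ‖f z‖ₑ ^ 2 * ballWeight a z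
        ≤ (2 * ENNReal.ofReal M ^ 2 + 8 * ((∫⁻ t in Set.Ioc (1 / 2 : ℝ) 1, G ((t : ℂ) • z)) *
            (K₁ * ballWeight (-ε) z))) * ballWeight a z := by
          gcongr
          refine h3.trans ?_
          gcongr
          exact h₁ d z hz
      _ = 2 * ENNReal.ofReal M ^ 2 * ballWeight a z + 8 * K₁ *
          ((ballWeight a z * ballWeight (-ε) z) *
            ∫⁻ t in Set.Ioc (1 / 2 : ℝ) 1, G ((t : ℂ) • z)) := by ring
      _ = _ := by rw [ballWeight_mul _ _ hz, ← sub_eq_add_neg]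
  have hc₁ : 2 * ENNReal.ofReal M ^ 2 ≠ ⊤ :=
    ENNReal.mul_ne_top (by simp) (ENNReal.pow_ne_top ENNReal.ofReal_ne_top)
  have hc₂ : 8 * K₁ ≠ ⊤ := ENNReal.mul_ne_top (by simp) hK₁
  have hGE : ∫⁻ w in unitBall d, G w * ballWeight (a - ε + 1) w =
      weightedEnergy d (a + 2) (numberOp d f) := by
    refine setLIntegral_congr_fun (measurableSet_unitBall d) fun w hw => ?_
    simp only [hG, Set.indicator_of_mem hw]
    rw [mul_assoc, ballWeight_mul _ _ hw]
    congr 2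
    ring
  calc weightedEnergy d a f
      ≤ ∫⁻ z in unitBall d, (2 * ENNReal.ofReal M ^ 2 * ballWeight a z + 8 * K₁ *
        (ballWeight (a - ε) z * ∫⁻ t in Set.Ioc (1 / 2 : ℝ) 1, G ((t : ℂ) • z))) :=
        setLIntegral_mono' (measurableSet_unitBall d) hpt
    _ = 2 * ENNReal.ofReal M ^ 2 * (∫⁻ z in unitBall d, ballWeight a z) + 8 * K₁ *
        ∫⁻ z in unitBall d,
          ballWeight (a - ε) z * ∫⁻ t in Set.Ioc (1 / 2 : ℝ) 1, G ((t : ℂ) • z) := by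
        rw [lintegral_add_left ((measurable_ballWeight a).const_mul _),
          lintegral_const_mul' _ _ hc₁, lintegral_const_mul' _ _ hc₂]
    _ ≤ 2 * ENNReal.ofReal M ^ 2 * (∫⁻ z in unitBall d, ballWeight a z) + 8 * K₁ *
        (K₂ * weightedEnergy d (a + 2) (numberOp d f)) := by
        rw [← hGE]
        gcongr
        exact h₂ G hGm
    _ < ⊤ := ENNReal.add_lt_top.2
        ⟨ENNReal.mul_lt_top hc₁.lt_top (lintegral_ballWeight_lt_top d ha),
          ENNReal.mul_lt_top hc₂.lt_top (ENNReal.mul_lt_top hK₂.lt_top h)⟩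

/-! ### Change of the auxiliary integer, and products. -/

theorem mem_genBergmanSpace_iff {d n : ℕ} {l : ℝ} (h : (d : ℝ) < l + 2 * n)
    {f : EuclideanSpace ℂ (Fin d) → ℂ} : f ∈ genBergmanSpace d n l ↔
      IsHolo d f ∧ ∀ k ≤ n, weightedEnergy d (l + 2 * n - d - 1) ((numberOp d)^[k] f) < ⊤ := by
  simp only [genBergmanSpace, Set.mem_ofPred_eq]
  refine and_congr_right fun hf => forall₂_congr fun k _ => ?_
  exact mem_bergmanSpace_iff h (hf.holo_numberOp_iterate k)

theorem IsHolo.weightedEnergy_iterate_of_le {d n : ℕ} {l : ℝ}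
    {f : EuclideanSpace ℂ (Fin d) → ℂ} (hf : IsHolo d f)
    (h : ∀ k ≤ n, weightedEnergy d (l + 2 * n - d - 1) ((numberOp d)^[k] f) < ⊤)
    {p i : ℕ} (hp : n ≤ p) (hi : i ≤ p) :
    weightedEnergy d (l + 2 * p - d - 1) ((numberOp d)^[i] f) < ⊤ := by
  induction p, hp using Nat.le_induction generalizing i with
  | base => exact h i hi
  | succ p hp ih =>
    rcases Nat.le_succ_iff.1 hi with hi' | rfl
    · refine (weightedEnergy_mono_exponent ?_ _).trans_lt (ih hi')
      push_cast
      linarith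
    · rw [Function.iterate_succ_apply']
      convert (hf.holo_numberOp_iterate p).weightedEnergy_numberOp_lt_top (ih le_rfl) using 2
      push_cast
      ring

/-- Each decrease of n is one use of the Hardy inequality; l + 2p > d is what keeps the exponents
above -1. -/
theorem IsHolo.weightedEnergy_iterate_of_ge {d n : ℕ} {l : ℝ}
    {f : EuclideanSpace ℂ (Fin d) → ℂ} (hf : IsHolo d f)
    (h : ∀ k ≤ n, weightedEnergy d (l + 2 * n - d - 1) ((numberOp d)^[k] f) < ⊤)
    {p i : ℕ} (hp : p ≤ n) (hpl : (d : ℝ) < l + 2 * p) (hi : i ≤ p) :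
    weightedEnergy d (l + 2 * p - d - 1) ((numberOp d)^[i] f) < ⊤ := by
  induction n, hp using Nat.le_induction with
  | base => exact h i hi
  | succ n hn ih =>
    refine ih fun k hk => ?_
    have hn' : (p : ℝ) ≤ n := by exact_mod_cast hn
    refine (hf.holo_numberOp_iterate k).weightedEnergy_lt_top_of_numberOp (by linarith) ?_
    have := h (k + 1) (by omega)
    rw [Function.iterate_succ_apply'] at this
    convert this using 2
    push_cast
    ring

/-- For i ≥ n the energy of N^i f gives the growth directly. Smaller i are reached by integrating
along rays, with no restriction from d, since l/2 + i > 0. -/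
theorem IsHolo.hasBoundaryGrowth_iterate {d n : ℕ} {l : ℝ} (hl : 0 < l)
    {f : EuclideanSpace ℂ (Fin d) → ℂ} (hf : IsHolo d f)
    (h : ∀ k ≤ n, weightedEnergy d (l + 2 * n - d - 1) ((numberOp d)^[k] f) < ⊤) (i : ℕ) :
    HasBoundaryGrowth d (l / 2 + i) ((numberOp d)^[i] f) := by
  -- m bounds the number of integrations still needed to come down from order n to order i.
  have key : ∀ m i : ℕ, n ≤ i + m → HasBoundaryGrowth d (l / 2 + i) ((numberOp d)^[i] f) := by
    intro m
    induction m with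
    | zero =>
      intro i hi
      convert (hf.holo_numberOp_iterate i).hasBoundaryGrowth
        (hf.weightedEnergy_iterate_of_le h (p := i) hi le_rfl) using 1
      ring
    | succ m ih =>
      intro i hi
      refine (hf.holo_numberOp_iterate i).hasBoundaryGrowth_of_numberOp (by positivity) ?_
      have := ih (i + 1) (by omega)
      rw [Function.iterate_succ_apply'] at this
      convert this using 1
      push_cast
      ring
  exact key n i (by omega)

theorem weightedEnergy_mul_lt_top {d : ℕ} {a b : ℝ} {f g : EuclideanSpace ℂ (Fin d) → ℂ}
    (hf : weightedEnergy d a f < ⊤) (hg : HasBoundaryGrowth d b g) :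
    weightedEnergy d (a + 2 * b) (fun z => f z * g z) < ⊤ := by
  obtain ⟨C, hC, hg⟩ := hg
  have h : weightedEnergy d (a + 2 * b) (fun z => f z * g z) ≤
      ENNReal.ofReal (C ^ 2) * weightedEnergy d a f := by
    rw [weightedEnergy, weightedEnergy, ← lintegral_const_mul' _ _ ENNReal.ofReal_ne_top]
    refine setLIntegral_mono' (measurableSet_unitBall d) fun z hz => ?_
    have hδ := one_sub_norm_sq_pos hz
    have h1 : ‖g z‖ₑ ^ 2 ≤ ENNReal.ofReal (C ^ 2) * ballWeight (-(2 * b)) z := by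
      rw [← ofReal_norm, ← ENNReal.ofReal_pow (norm_nonneg _), ballWeight,
        ← ENNReal.ofReal_mul (by positivity)]
      refine ENNReal.ofReal_le_ofReal ?_
      calc ‖g z‖ ^ 2 ≤ (C * (1 - ‖z‖ ^ 2) ^ (-b)) ^ 2 := by gcongr; exact hg z hz
        _ = _ := by
          rw [mul_pow, ← Real.rpow_natCast (_ ^ _), ← Real.rpow_mul hδ.le]
          congr 2
          push_cast
          ring
    calc ‖f z * g z‖ₑ ^ 2 * ballWeight (a + 2 * b) z
        = ‖f z‖ₑ ^ 2 * ‖g z‖ₑ ^ 2 * ballWeight (a + 2 * b) z := by rw [enorm_mul, mul_pow]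
      _ ≤ ‖f z‖ₑ ^ 2 * (ENNReal.ofReal (C ^ 2) * ballWeight (-(2 * b)) z) *
          ballWeight (a + 2 * b) z := by gcongr
      _ = ENNReal.ofReal (C ^ 2) *
          (‖f z‖ₑ ^ 2 * (ballWeight (-(2 * b)) z * ballWeight (a + 2 * b) z)) := by ring
      _ = _ := by
          rw [ballWeight_mul _ _ hz]
          congr 3
          ring
  exact h.trans_lt (ENNReal.mul_lt_top ENNReal.ofReal_lt_top hf)

theorem weightedEnergy_iterate_mul_iterate_lt_top {d n₁ n₂ : ℕ} {l₁ l₂ : ℝ} (hl₁ : 0 < l₁)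
    (hl₂ : 0 < l₂) {f g : EuclideanSpace ℂ (Fin d) → ℂ} (hf : IsHolo d f) (hg : IsHolo d g)
    (hfE : ∀ k ≤ n₁, weightedEnergy d (l₁ + 2 * n₁ - d - 1) ((numberOp d)^[k] f) < ⊤)
    (hgE : ∀ k ≤ n₂, weightedEnergy d (l₂ + 2 * n₂ - d - 1) ((numberOp d)^[k] g) < ⊤)
    {i j : ℕ} (hij : i + j ≤ n₁ + n₂) :
    weightedEnergy d (l₁ + l₂ + 2 * (n₁ + n₂ : ℕ) - d - 1)
      (fun z => (numberOp d)^[i] f z * (numberOp d)^[j] g z) < ⊤ := by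
  rcases le_total j n₂ with hj | hj
  -- j ≤ n₂ gives p ≥ n₁, so N^i f has finite energy at level p ≥ i. The growth of N^j g adds l₂ +
  -- 2j to the exponent, making l₁ + l₂ + 2(p + j) - d - 1.
  · obtain ⟨p, hp⟩ : ∃ p, n₁ + n₂ = p + j := ⟨n₁ + n₂ - j, by omega⟩
    have h1 := hf.weightedEnergy_iterate_of_le hfE (p := p) (i := i) (by omega) (by omega)
    convert weightedEnergy_mul_lt_top h1 (hg.hasBoundaryGrowth_iterate hl₂ hgE j) using 2
    rw [hp]
    push_cast
    ring
  · obtain ⟨p, hp⟩ : ∃ p, n₁ + n₂ = p + i := ⟨n₁ + n₂ - i, by omega⟩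
    have h1 := hg.weightedEnergy_iterate_of_le hgE (p := p) (i := j) (by omega) (by omega)
    simp only [mul_comm ((numberOp d)^[i] f _)]
    convert weightedEnergy_mul_lt_top h1 (hf.hasBoundaryGrowth_iterate hl₁ hfE i) using 2
    rw [hp]
    push_cast
    ring

/-- Iterates of the number operator on a product, through the Leibniz rule. -/
theorem weightedEnergy_iterate_numberOp_mul_lt_top {d n : ℕ} {a : ℝ}
    {f g : EuclideanSpace ℂ (Fin d) → ℂ} (hf : IsHolo d f) (hg : IsHolo d g)
    (h : ∀ i j : ℕ, i + j ≤ n →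
      weightedEnergy d a (fun z => (numberOp d)^[i] f z * (numberOp d)^[j] g z) < ⊤)
    {k : ℕ} (hk : k ≤ n) :
    weightedEnergy d a ((numberOp d)^[k] (fun z => f z * g z)) < ⊤ := by
  have hadd : ∀ (k : ℕ) {u v : EuclideanSpace ℂ (Fin d) → ℂ}, IsHolo d u → IsHolo d v →
      Set.EqOn ((numberOp d)^[k] (fun z => u z + v z))
        (fun z => (numberOp d)^[k] u z + (numberOp d)^[k] v z) (unitBall d) := by
    intro k u v hu hv
    induction k with
    | zero => exact fun z _ => rfl
    | succ k ih =>
      simp only [Function.iterate_succ_apply']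
      exact (numberOp_congr ih).trans
        (numberOp_add (hu.holo_numberOp_iterate k) (hv.holo_numberOp_iterate k))
  -- The innermost N is distributed first, with i and j generalized; this avoids binomial
  -- coefficients.
  have key : ∀ k i j : ℕ, i + j + k ≤ n → weightedEnergy d a ((numberOp d)^[k]
      (fun z => (numberOp d)^[i] f z * (numberOp d)^[j] g z)) < ⊤ := by
    intro k
    induction k with
    | zero => exact fun i j hij => h i j hij
    | succ k ih =>
      intro i j hij
      have hfi := hf.holo_numberOp_iterate
      have hgi := hg.holo_numberOp_iterate
      have h1 := ih (i + 1) j (by omega)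
      have h2 := ih i (j + 1) (by omega)
      have hH1 := (hfi (i + 1)).mul (hgi j)
      have hH2 := (hfi i).mul (hgi (j + 1))
      have heq := (numberOp_iterate_congr (numberOp_mul (hfi i) (hgi j)) k).trans
        (hadd k ((hfi i).holo_numberOp.mul (hgi j)) ((hfi i).mul (hgi j).holo_numberOp))
      rw [Function.iterate_succ_apply, weightedEnergy_congr a heq]
      simp only [Function.iterate_succ_apply'] at h1 h2 hH1
      exact weightedEnergy_add_lt_top (hH1.holo_numberOp_iterate k) h1 h2
  exact key k 0 0 (by omega)

theorem mainTheorem9 (d : ℕ) (l₁ l₂ : ℝ) (hl₁ : 0 < l₁) (hl₂ : 0 < l₂)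
    (n₁ n₂ n₃ : ℕ) (hn₁ : (d : ℝ) < l₁ + 2 * n₁) (hn₂ : (d : ℝ) < l₂ + 2 * n₂)
    (hn₃ : (d : ℝ) < l₁ + l₂ + 2 * n₃)
    (f g : EuclideanSpace ℂ (Fin d) → ℂ)
    (hf : f ∈ genBergmanSpace d n₁ l₁) (hg : g ∈ genBergmanSpace d n₂ l₂) :
    (fun z => f z * g z) ∈ genBergmanSpace d n₃ (l₁ + l₂) := by
  obtain ⟨hfH, hfE⟩ := (mem_genBergmanSpace_iff hn₁).1 hf
  obtain ⟨hgH, hgE⟩ := (mem_genBergmanSpace_iff hn₂).1 hg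
  have hH := hfH.mul hgH
  -- The product is first placed at level n₁ + n₂, where all Leibniz terms share one exponent, and
  -- then moved to n₃.
  have hE : ∀ k ≤ n₁ + n₂, weightedEnergy d (l₁ + l₂ + 2 * (n₁ + n₂ : ℕ) - d - 1)
      ((numberOp d)^[k] (fun z => f z * g z)) < ⊤ := fun k hk =>
    weightedEnergy_iterate_numberOp_mul_lt_top hfH hgH
      (fun i j hij => weightedEnergy_iterate_mul_iterate_lt_top hl₁ hl₂ hfH hgH hfE hgE hij) hk
  refine (mem_genBergmanSpace_iff hn₃).2 ⟨hH, fun k hk => ?_⟩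
  rcases le_total (n₁ + n₂) n₃ with h | h
  · exact hH.weightedEnergy_iterate_of_le hE h hk
  · exact hH.weightedEnergy_iterate_of_ge hE h hn₃ hk
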